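/- Let $\gamma_1(s)=(-s,-s^2,-s^3)$ for $s\in[0,1]$ and $\gamma_2(t)=(-t,t^2,0)$ for $t\in[0,\tfrac13(2+\sqrt7)]$, let $C\subset\mathbb{R}^3$ be the convex hull of the two curves, and let $K=\operatorname{cone}(C\times\{1\})\subset\mathbb{R}^4$ be its homogenization. Notation, for a closed convex set $S$ in a Euclidean space: a face $F$ of $S$ is a nonempty convex subset such that any open segment with end points in $S$ that meets $F$ has both end points in $F$; it is proper ($F\lhd S$) if $F\ne S$. The tangent cone $T(x;S)$ of $S$ at $x\in S$ is the upper limit of the sets $t(S-x)$ as $t\to+\infty$, i.e. the set of limits of $t_k(x_k-x)$ with $x_k\in S$ and $t_k\to+\infty$. The set $S$ is facially exposed if every proper face is the set of maximizers over $S$ of a linear functional. A closed convex cone $S$ is tangentially exposed if $T(x;S)\cap\operatorname{span}F=T(x;F)$ for all $F\lhd S$ and all $x\in F$, and facially dual complete if $S^*+F^\perp$ is closed for every $F\lhd S$, where $S^*=\{u:\langle u,x\rangle\ge 0\ \forall x\in S\}$ and $F^\perp=\{u:\langle u,x\rangle=0\ \forall x\in F\}$. Then $K$ is a regular cone (closed,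 convex, pointed, with nonempty interior) that is facially exposed and tangentially exposed, but $K$ is not facially dual complete. Moreover, the tangent cone $T(0;C)\subset\mathbb{R}^3$ of $C$ at the origin is neither facially exposed nor tangentially exposed, and the same holds for the tangent cone $T((0,0,0,1);K)\subset\mathbb{R}^4$ of $K$ at the corresponding point. -/

import Mathlib

open scoped Pointwise

/-- `F` is a face of the convex set `C`: a nonempty convex subset of `C` such that whenever an
open segment with end points in `C` meets `F`, both end points lie in `F`. -/
structure IsConvexFace {E : Type*} [AddCommGroup E] [Module ℝ E] (C F : Set E) : Prop where
  nonempty : F.Nonempty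
  convex : Convex ℝ F
  isExtreme : IsExtreme ℝ C F

/-- `F ◁ C`: a face of `C` different from `C`. -/
def IsProperFace {E : Type*} [AddCommGroup E] [Module ℝ E] (C F : Set E) : Prop :=
  IsConvexFace C F ∧ F ≠ C

/-- Every proper face of `C` is exposed, i.e. is the set of maximizers over `C` of a (continuous)
linear functional. -/
def IsFaciallyExposed {E : Type*} [NormedAddCommGroup E] [NormedSpace ℝ E] (C : Set E) : Prop :=
  ∀ F : Set E, IsProperFace C F → IsExposed ℝ C F

/-- Tangential exposure of a closed convex cone `K`: `T(x; K) ∩ span F = T(x; F)` for all proper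
faces `F` of `K` and all `x ∈ F`. The tangent cone `T(x; S)`, the upper limit of the sets
`t (S - x)` as `t → +∞`, is `posTangentConeAt S x`. -/
def IsTangentiallyExposed {E : Type*} [NormedAddCommGroup E] [NormedSpace ℝ E]
    (K : Set E) : Prop :=
  ∀ F : Set E, IsProperFace K F → ∀ x ∈ F,
    posTangentConeAt K x ∩ (Submodule.span ℝ F : Set E) = posTangentConeAt F x

/-- Facial dual completeness of a closed convex cone `K`: `K* + F^⊥` is closed for every proper
face `F` of `K`, the dual space being identified with `E` through the inner product. -/
def IsFaciallyDualComplete {E : Type*} [NormedAddCommGroup E] [InnerProductSpace ℝ E]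
    [CompleteSpace E] (K : Set E) : Prop :=
  ∀ F : Set E, IsProperFace K F →
    IsClosed ((ProperCone.innerDual K : Set E) + {s : E | ∀ x ∈ F, inner ℝ s x = 0})

/-- The arc `γ₁(s) = (-s, -s², -s³)`, `s ∈ [0, 1]`, of a twisted cubic. -/
noncomputable def cubicArc : Set (EuclideanSpace ℝ (Fin 3)) :=
  (fun s : ℝ => !₂[-s, -s ^ 2, -s ^ 3]) '' Set.Icc 0 1

/-- The arc `γ₂(t) = (-t, t², 0)`, `t ∈ [0, (2 + √7) / 3]`, of a parabola. -/
noncomputable def parabolaArc : Set (EuclideanSpace ℝ (Fin 3)) :=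
  (fun t : ℝ => !₂[-t, t ^ 2, 0]) '' Set.Icc 0 ((2 + √7) / 3)

/-- The convex hull `C` of the two arcs. -/
noncomputable def cubicBody : Set (EuclideanSpace ℝ (Fin 3)) :=
  convexHull ℝ (cubicArc ∪ parabolaArc)

/-- The homogenization `cone (C × {1})` in `ℝ⁴` of a set `C` in `ℝ³`: the smallest convex cone
that contains `0` and all points `(x, 1)` with `x ∈ C`. -/
noncomputable def homogenization (C : Set (EuclideanSpace ℝ (Fin 3))) :
    PointedCone ℝ (EuclideanSpace ℝ (Fin 4)) :=
  PointedCone.hull ℝ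
    ((fun x : EuclideanSpace ℝ (Fin 3) =>
      (!₂[x 0, x 1, x 2, 1] : EuclideanSpace ℝ (Fin 4))) '' C)

/-- The cone `K = cone (C × {1})`. -/
noncomputable def cubicCone : Set (EuclideanSpace ℝ (Fin 4)) :=
  (homogenization cubicBody : Set (EuclideanSpace ℝ (Fin 4)))

/-!
The cone `K = cubicCone` is generated by the two arcs lifted to `ℝ⁴`, so a face of `K` is determined
by the points of the arcs that it contains, and a proper face lies in the kernel of a nonzero linear
functional supporting both arcs. Such a functional restricts to a cubic `m + a s + b s² + c s³` on
`[0, 1]` and to a quadratic `m + a t - b t²` on `[0, (2 + √7) / 3]`, both nonnegative, and the faces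
are found by listing the possible common zero sets (`contact_set_cases`). They are spanned by the
parabola (the planar face), by the triangle with vertices `0`, `γ₁(1)`, `γ₂((2 + √7) / 3)`, by the
edges from `0` to `γ₁(s)` and from `γ₁(s)` to `γ₂((2 + √7) / 3 * s)`, or by subfaces of these. The
ratio `(2 + √7) / 3` is that of the parameters of two points at which the arcs have a common tangent
plane.

All faces other than the planar one are simplicial, and explicit functionals expose them and cut out
their facets. This gives facial exposedness, and also tangential exposedness: at a point of a
simplicial face the tangent cone is given by the signs of some coordinates, and these signs are
controlled by the facet functionals (`IsExposedSimplex`).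

At the planar face, a functional `m + a t - b t²` that is nonnegative on the parabola extends to a
functional supporting `K` (`exists_nonneg_extension`) except for the multiples of `t²`, that is, of
the coordinate `y`. Near the origin the cubic arc has `y = -s²` and `z = -s³`, so `y - c z` is never
nonnegative on it, whereas for every `ε > 0` some `y - ε x - c z` is. Hence `y` is a limit of
elements of `K* + F^⊥` outside this set, and `K` is not facially dual complete. The same functionals
`y - ε x - c z` show that `K` is nevertheless tangentially exposed at the origin.

In the tangent cone at the origin the arcs become the directions `(-1, -s, -s²)` and `(-1, t, 0)`,
up to scaling. The ray through `(-1, 0, 0)` is a face, but the first family forces an exposing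
functional to vanish on the whole face `z = 0`, and forces the tangent cone at that ray to contain
`(0, -1, 0)`, which is not tangent to the face `z = 0`
(`Convex.not_exposed_posTangentConeAt`).
-/

open Filter Topology Set

/-! ### Tangent cones of convex sets -/

section TangentCone

variable {E : Type*} [NormedAddCommGroup E] [NormedSpace ℝ E] {S : Set E} {x v : E}

theorem isClosed_posTangentConeAt (S : Set E) (x : E) : IsClosed (posTangentConeAt S x) := by
  rw [posTangentConeAt, tangentConeAt_def]
  exact isClosed_setOfPred_clusterPt

theorem Convex.add_smul_mem_of_le (hS : Convex ℝ S) (hx : x ∈ S) {t t' : ℝ} (ht : 0 < t)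
    (h : x + t • v ∈ S) (ht' : 0 ≤ t') (hle : t' ≤ t) : x + t' • v ∈ S := by
  have h1 := hS.add_smul_mem hx h (t := t' / t)
    ⟨by positivity, div_le_one_of_le₀ hle ht.le⟩
  rwa [smul_smul, div_mul_cancel₀ _ ht.ne'] at h1

theorem Convex.mem_posTangentConeAt (hS : Convex ℝ S) (hx : x ∈ S) {t : ℝ} (ht : 0 < t)
    (h : x + t • v ∈ S) : v ∈ posTangentConeAt S x := by
  apply mem_posTangentConeAt_of_frequently_mem
  apply Eventually.frequently
  filter_upwards [Ioo_mem_nhdsGT ht] with t' ht'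
  exact hS.add_smul_mem_of_le hx ht h ht'.1.le ht'.2.le

theorem Convex.posTangentConeAt_eq_closure (hS : Convex ℝ S) (hx : x ∈ S) :
    posTangentConeAt S x = closure {v | ∃ t : ℝ, 0 < t ∧ x + t • v ∈ S} := by
  apply Subset.antisymm
  · intro y hy
    obtain ⟨α, l, hl, c, d, -, hds, hcd⟩ := exists_fun_of_mem_tangentConeAt hy
    refine mem_closure_of_tendsto hcd ?_
    filter_upwards [hds] with n hn
    rcases eq_or_ne (c n) 0 with h0 | h0
    · exact ⟨1, one_pos, by simpa [h0] using hx⟩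
    · have hpos : 0 < (c n : ℝ) := NNReal.coe_pos.2 (pos_iff_ne_zero.2 h0)
      refine ⟨(c n : ℝ)⁻¹, inv_pos.2 hpos, ?_⟩
      rwa [NNReal.smul_def, inv_smul_smul₀ hpos.ne']
  · refine closure_minimal ?_ (isClosed_posTangentConeAt S x)
    rintro v ⟨t, ht, h⟩
    exact hS.mem_posTangentConeAt hx ht h

theorem Convex.convex_posTangentConeAt (hS : Convex ℝ S) (hx : x ∈ S) :
    Convex ℝ (posTangentConeAt S x) := by
  rw [hS.posTangentConeAt_eq_closure hx]
  apply Convex.closure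
  rintro u ⟨t, ht, hu⟩ v ⟨r, hr, hv⟩ a b ha hb hab
  have hm : 0 < min t r := lt_min ht hr
  refine ⟨min t r, hm, ?_⟩
  have h := hS (hS.add_smul_mem_of_le hx ht hu hm.le (min_le_left _ _))
    (hS.add_smul_mem_of_le hx hr hv hm.le (min_le_right _ _)) ha hb hab
  convert h using 1
  have : x = (a + b) • x := by rw [hab, one_smul]
  nth_rw 1 [this]
  module

theorem Convex.smul_mem_posTangentConeAt (hS : Convex ℝ S) (hx : x ∈ S) {r : ℝ} (hr : 0 < r)
    (hv : v ∈ posTangentConeAt S x) : r • v ∈ posTangentConeAt S x := by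
  rw [hS.posTangentConeAt_eq_closure hx] at hv ⊢
  refine map_mem_closure (continuous_const_smul r) hv ?_
  rintro u ⟨t, ht, hu⟩
  refine ⟨t / r, by positivity, ?_⟩
  rwa [smul_smul, div_mul_cancel₀ _ hr.ne']

/-- A linear functional that is nonnegative on a convex set and vanishes at one of its points is
nonnegative on the tangent cone at this point. -/
theorem Convex.nonneg_of_mem_posTangentConeAt (hS : Convex ℝ S) (hx : x ∈ S) (l : E →L[ℝ] ℝ)
    (hl : ∀ y ∈ S, 0 ≤ l y) (hlx : l x = 0) (hv : v ∈ posTangentConeAt S x) : 0 ≤ l v := by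
  rw [hS.posTangentConeAt_eq_closure hx] at hv
  refine closure_minimal ?_ (isClosed_le continuous_const l.continuous) hv
  rintro u ⟨t, ht, hu⟩
  have := hl _ hu
  rw [map_add, map_smul, hlx, zero_add, smul_eq_mul] at this
  exact nonneg_of_mul_nonneg_right this ht

theorem Convex.posTangentConeAt_subset_span {F : Set E} [FiniteDimensional ℝ E]
    (hF : Convex ℝ F) (hx : x ∈ F) :
    posTangentConeAt F x ⊆ (Submodule.span ℝ F : Set E) := by
  rw [hF.posTangentConeAt_eq_closure hx]
  refine closure_minimal ?_ (Submodule.closed_of_finiteDimensional _)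
  rintro u ⟨t, ht, hu⟩
  have h := sub_mem (Submodule.subset_span (R := ℝ) hu) (Submodule.subset_span hx)
  rw [add_sub_cancel_left] at h
  exact (Submodule.smul_mem_iff _ ht.ne').1 h

end TangentCone

/-! ### Compactness of convex hulls and closedness of cones -/

section Compact

variable {E : Type*} [NormedAddCommGroup E] [NormedSpace ℝ E] [FiniteDimensional ℝ E]

/-- By Carathéodory's theorem, the convex hull of a compact set in dimension `n` is a continuous
image of a product of a simplex with `n + 1` copies of the set. -/
theorem IsCompact.isCompact_convexHull {s : Set E} (hs : IsCompact s) :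
    IsCompact (convexHull ℝ s) := by
  rcases s.eq_empty_or_nonempty with rfl | ⟨x₀, hx₀⟩
  · simp
  let n := Module.finrank ℝ E + 1
  have hK : IsCompact (stdSimplex ℝ (Fin n) ×ˢ Set.univ.pi fun _ : Fin n => s) :=
    (isCompact_stdSimplex ℝ (Fin n)).prod (isCompact_univ_pi fun _ => hs)
  have hf : Continuous fun p : (Fin n → ℝ) × (Fin n → E) => ∑ i, p.1 i • p.2 i := by fun_prop
  convert hK.image hf using 1
  apply Subset.antisymm
  · intro x hx
    obtain ⟨ι, _, z, w, hz, hind, hw, hw1, rfl⟩ := eq_pos_convex_span_of_mem_convexHull hx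
    have hcard : Fintype.card ι ≤ Fintype.card (Fin n) := by
      rw [Fintype.card_fin]
      exact hind.card_le_finrank_succ.trans (Nat.succ_le_succ (Submodule.finrank_le _))
    obtain ⟨e⟩ := Function.Embedding.nonempty_of_card_le hcard
    refine ⟨(Function.extend e w 0, Function.extend e z fun _ => x₀), ⟨⟨?_, ?_⟩, ?_⟩, ?_⟩
    · intro j
      by_cases hj : ∃ i, e i = j
      · obtain ⟨i, rfl⟩ := hj
        simpa [e.injective.extend_apply] using (hw i).le
      · simp [Function.extend_apply' _ _ _ hj]
    · rw [← hw1]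
      refine (Fintype.sum_of_injective e e.injective _ _ ?_ ?_).symm
      · intro j hj
        simp [Function.extend_apply' _ _ _ hj]
      · simp [e.injective.extend_apply]
    · intro j _
      by_cases hj : ∃ i, e i = j
      · obtain ⟨i, rfl⟩ := hj
        simpa [e.injective.extend_apply] using hz (mem_range_self i)
      · simpa [Function.extend_apply' _ _ _ hj] using hx₀
    · refine (Fintype.sum_of_injective e e.injective _ _ ?_ ?_).symm
      · intro j hj
        simp [Function.extend_apply' _ _ _ hj]
      · simp [e.injective.extend_apply]
  · rintro _ ⟨p, ⟨⟨h0, h1⟩, h2⟩, rfl⟩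
    exact (convex_convexHull ℝ s).sum_mem (fun i _ => h0 i) h1
      fun i _ => subset_convexHull ℝ s (h2 i (mem_univ i))

end Compact

/-! ### Faces of convex cones -/

section Faces

variable {E : Type*} [NormedAddCommGroup E] [NormedSpace ℝ E] {G : Set E} {K F : PointedCone ℝ E}

theorem PointedCone.nonneg_of_mem_hull {l : E →L[ℝ] ℝ} (hl : ∀ g ∈ G, 0 ≤ l g) {x : E}
    (hx : x ∈ PointedCone.hull ℝ G) : 0 ≤ l x := by
  induction hx using Submodule.span_induction with
  | mem g hg => exact hl g hg
  | zero => simp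
  | add u v _ _ hu hv => rw [map_add]; exact add_nonneg hu hv
  | smul c u _ hu =>
    rw [Nonneg.mk_smul c.1 c.2 u, map_smul]
    exact smul_nonneg c.2 hu

/-- A convex face of a convex cone is itself a convex cone. -/
theorem IsConvexFace.exists_isFaceOf {F : Set E} (hF : IsConvexFace (K : Set E) F) :
    ∃ F' : PointedCone ℝ E, (F' : Set E) = F ∧ F'.IsFaceOf K := by
  have hsub := hF.isExtreme.subset
  -- A point `x` of the face is the midpoint of `0` and `2 • x`.
  have key : ∀ x ∈ F, ∀ r : ℝ, 0 ≤ r → r • x ∈ F := by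
    intro x hx r hr
    have hseg : ∀ r : ℝ, 1 < r → x ∈ openSegment ℝ (0 : E) (r • x) := by
      intro r hr
      refine ⟨1 - r⁻¹, r⁻¹, sub_pos.2 (inv_lt_one_of_one_lt₀ hr), by positivity, by ring, ?_⟩
      rw [smul_zero, zero_add, inv_smul_smul₀ (by positivity)]
    have h0 : (0 : E) ∈ F := hF.isExtreme.left_mem_of_mem_openSegment K.zero_mem
      (K.smul_mem zero_le_two (hsub hx)) hx (hseg 2 one_lt_two)
    rcases le_or_gt r 1 with h1 | h1
    · have := hF.convex h0 hx (sub_nonneg.2 h1) hr (by ring)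
      rwa [smul_zero, zero_add] at this
    · exact hF.isExtreme.right_mem_of_mem_openSegment K.zero_mem
        (K.smul_mem hr (hsub hx)) hx (hseg r h1)
  obtain ⟨z, hz⟩ := hF.nonempty
  let F' : PointedCone ℝ E :=
    { carrier := F
      zero_mem' := by simpa using key z hz 0 le_rfl
      add_mem' := by
        intro a b ha hb
        have := hF.convex (key a ha 2 zero_le_two) (key b hb 2 zero_le_two)
          (by norm_num : (0 : ℝ) ≤ 1 / 2) (by norm_num : (0 : ℝ) ≤ 1 / 2) (by norm_num)
        simpa [smul_smul] using this
      smul_mem' := fun c x hx => key x hx c.1 c.2 }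
  refine ⟨F', rfl, hsub, ?_⟩
  intro x y a hx hy ha h
  have h2 : (1 + a)⁻¹ • (a • x + y) ∈ F := key _ h _ (by positivity)
  refine hF.isExtreme.left_mem_of_mem_openSegment hx hy h2
    ⟨(1 + a)⁻¹ * a, (1 + a)⁻¹, by positivity, by positivity, by field_simp; ring, ?_⟩
  rw [smul_add, smul_smul]

/-- A face of a convex cone is generated by those generators of the cone that it contains. -/
theorem PointedCone.IsFaceOf.eq_hull_inter (hF : F.IsFaceOf (PointedCone.hull ℝ G)) :
    F = PointedCone.hull ℝ (G ∩ F) := by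
  apply le_antisymm
  · intro x hxF
    have hx := hF.le hxF
    induction hx using Submodule.span_induction with
    | mem g hg => exact Submodule.subset_span ⟨hg, hxF⟩
    | zero => exact zero_mem _
    | add u v hu hv ihu ihv =>
      exact add_mem (ihu (hF.mem_of_add_mem_left hu hv hxF))
        (ihv (hF.mem_of_add_mem_right hu hv hxF))
    | smul c u hu ih =>
      rcases eq_or_ne c 0 with rfl | hc
      · simp
      · refine Submodule.smul_mem _ c (ih ?_)
        have := Submodule.smul_mem F c⁻¹ hxF
        rwa [inv_smul_smul₀ hc] at this
  · exact Submodule.span_le.2 fun g hg => hg.2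

/-- A proper face of a convex cone with interior points lies in a supporting hyperplane. -/
theorem PointedCone.IsFaceOf.exists_supporting (hF : F.IsFaceOf K) (hne : F ≠ K)
    (hK : (interior (K : Set E)).Nonempty) :
    ∃ l : E →L[ℝ] ℝ, l ≠ 0 ∧ (∀ x ∈ K, 0 ≤ l x) ∧ ∀ x ∈ F, l x = 0 := by
  have hdisj : Disjoint (interior (K : Set E)) F := by
    rw [Set.disjoint_left]
    intro x hx hxF
    apply hne
    refine le_antisymm hF.le fun y hy => ?_
    -- A little beyond the interior point `x`, on the line from `y`, there is a point of the cone.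
    have hc : Tendsto (fun t : ℝ => x - t • y) (𝓝[>] 0) (𝓝 x) := by
      have : Continuous fun t : ℝ => x - t • y := by fun_prop
      simpa using (this.tendsto 0).mono_left nhdsWithin_le_nhds
    obtain ⟨t, ht, htpos⟩ := ((hc.eventually (mem_interior_iff_mem_nhds.1 hx)).and
      self_mem_nhdsWithin).exists
    exact hF.mem_of_smul_add_mem hy ht htpos (by simpa using hxF)
  obtain ⟨f, u, hf, hfK, hfF⟩ := geometric_hahn_banach_of_nonempty_interior K.convex F.convex
    hdisj hK ⟨0, F.zero_mem⟩
  have hu : u = 0 := le_antisymm (by simpa using hfF 0 F.zero_mem)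
    (by simpa using hfK 0 K.zero_mem)
  have hK0 : ∀ x ∈ K, f x ≤ 0 := fun x hx => hu ▸ hfK x hx
  refine ⟨-f, neg_ne_zero.2 hf, fun x hx => by simpa using hK0 x hx, fun x hx => ?_⟩
  have h1 := hK0 x (hF.le hx)
  have h2 := hfF x hx
  simp only [neg_apply]
  linarith

/-- A face of the cone generated by `G` is exposed as soon as its generators are the zeros in `G`
of a linear functional that is nonnegative on `G`. -/
theorem PointedCone.IsFaceOf.isExposed (hF : F.IsFaceOf (PointedCone.hull ℝ G))
    (l : E →L[ℝ] ℝ) (hl : ∀ g ∈ G, 0 ≤ l g) (hlF : ∀ g ∈ G, l g = 0 ↔ g ∈ F) :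
    IsExposed ℝ (PointedCone.hull ℝ G : Set E) F := by
  intro _
  have hl0 : ∀ x ∈ F, l x = 0 := by
    intro x hx
    rw [hF.eq_hull_inter] at hx
    induction hx using Submodule.span_induction with
    | mem g hg => exact (hlF g hg.1).2 hg.2
    | zero => simp
    | add u v _ _ hu hv => rw [map_add, hu, hv, add_zero]
    | smul c u _ hu => rw [Nonneg.mk_smul c.1 c.2 u, map_smul, hu, smul_zero]
  have hpos : ∀ x ∈ PointedCone.hull ℝ G, 0 ≤ l x := fun x hx => nonneg_of_mem_hull hl hx
  refine ⟨-l, Subset.antisymm (fun x hx => ⟨hF.le hx, fun y hy => ?_⟩) ?_⟩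
  · have := hpos y hy
    simpa [hl0 x hx] using this
  · rintro x ⟨hx, hmax⟩
    have hx0 : l x = 0 := le_antisymm (by simpa using hmax 0 (zero_mem _)) (hpos x hx)
    clear hmax
    show x ∈ F
    induction hx using Submodule.span_induction with
    | mem g hg => exact (hlF g hg).1 hx0
    | zero => exact F.zero_mem
    | add u v hu hv ihu ihv =>
      rw [map_add] at hx0
      exact F.add_mem (ihu (by linarith [hpos u hu, hpos v hv]))
        (ihv (by linarith [hpos u hu, hpos v hv]))
    | smul c u hu ih =>
      rcases eq_or_ne c 0 with rfl | hc
      · simp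
      · rw [Nonneg.mk_smul c.1 c.2 u, map_smul, smul_eq_mul] at hx0
        exact Submodule.smul_mem F c (ih ((mul_eq_zero.1 hx0).resolve_left (NNReal.coe_ne_zero.2 hc)))

end Faces

/-! ### Simplicial faces -/

section Simplex

variable {E : Type*} [NormedAddCommGroup E] [NormedSpace ℝ E] {G : Set E} {V : Finset E}
  {F : PointedCone ℝ E}

/-- A finite set `V` such that the generators of `cone G` lying in `V` are cut out by one linear
functional that is nonnegative on `G`, and such that each facet of the cone over `V` is cut out
from `V` by another one. The second condition forces `V` to be linearly independent. -/
structure IsExposedSimplex (G : Set E) (V : Finset E) : Prop where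
  exists_eq_zero_iff : ∃ l : E →L[ℝ] ℝ, (∀ g ∈ G, 0 ≤ l g) ∧ ∀ g ∈ G, l g = 0 ↔ g ∈ V
  exists_facet : ∀ v ∈ V, ∃ l : E →L[ℝ] ℝ,
    (∀ g ∈ G, 0 ≤ l g) ∧ 0 < l v ∧ ∀ u ∈ V, u ≠ v → l u = 0

theorem IsExposedSimplex.isExposed (hV : IsExposedSimplex G V)
    (hF : F.IsFaceOf (PointedCone.hull ℝ G)) (hFV : G ∩ F ⊆ V) :
    IsExposed ℝ (PointedCone.hull ℝ G : Set E) F := by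
  classical
  obtain ⟨l₀, hl₀, hl₀'⟩ := hV.exists_eq_zero_iff
  choose! l hl hlv hlu using hV.exists_facet
  refine hF.isExposed (l₀ + ∑ v ∈ V with v ∉ F, l v) (fun g hg => ?_) fun g hg => ⟨fun h => ?_, ?_⟩
  · simp only [add_apply, sum_apply]
    exact add_nonneg (hl₀ g hg) (Finset.sum_nonneg fun v hv => hl v (Finset.mem_filter.1 hv).1 g hg)
  · simp only [add_apply, sum_apply] at h
    have hnn : ∀ v ∈ V.filter (· ∉ F), 0 ≤ l v g :=
      fun v hv => hl v (Finset.mem_filter.1 hv).1 g hg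
    have h0 := hl₀ g hg
    have h1 := Finset.sum_nonneg hnn
    have hgV : g ∈ V := (hl₀' g hg).1 (by linarith)
    by_contra hgF
    have := Finset.single_le_sum hnn (Finset.mem_filter.2 ⟨hgV, hgF⟩)
    linarith [hlv g hgV]
  · intro hgF
    have hgV : g ∈ V := hFV ⟨hg, hgF⟩
    simp only [add_apply, sum_apply, (hl₀' g hg).2 hgV, zero_add]
    refine Finset.sum_eq_zero fun v hv => ?_
    obtain ⟨hv, hvF⟩ := Finset.mem_filter.1 hv
    exact hlu v hv g hgV fun h => hvF (h ▸ hgF)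

/-- In the coordinates given by the vertices, the tangent cone of a simplicial face at `x` is
described by the nonnegativity of the coordinates that vanish at `x`, and the functionals cutting
out the facets show that these coordinates are nonnegative on the tangent cone of the whole cone. -/
theorem IsExposedSimplex.posTangentConeAt_inter_span [FiniteDimensional ℝ E]
    (hV : IsExposedSimplex G V)
    (hF : F.IsFaceOf (PointedCone.hull ℝ G)) (hFV : G ∩ F ⊆ V) {x : E} (hx : x ∈ F) :
    posTangentConeAt (PointedCone.hull ℝ G : Set E) x ∩ (Submodule.span ℝ (F : Set E) : Set E) =
      posTangentConeAt (F : Set E) x := by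
  classical
  apply Subset.antisymm
  · rintro w ⟨hw, hwF⟩
    choose! l hl hlv hlu using hV.exists_facet
    set A : Finset E := V.filter (· ∈ G ∩ (F : Set E)) with hA
    have hAcoe : (A : Set E) = G ∩ F := by
      ext g
      simp only [hA, Finset.coe_filter, mem_ofPred_eq]
      exact ⟨fun h => h.2, fun h => ⟨hFV h, h⟩⟩
    have hFA : F = PointedCone.hull ℝ (A : Set E) := hAcoe ▸ hF.eq_hull_inter
    have hspan : Submodule.span ℝ (F : Set E) ≤ Submodule.span ℝ (A : Set E) := by
      refine Submodule.span_le.2 fun y hy => ?_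
      rw [SetLike.mem_coe, hFA] at hy
      exact PointedCone.hull_le_span (R := ℝ) (A : Set E) hy
    obtain ⟨c, -, rfl⟩ := Submodule.mem_span_finset.1 (hspan hwF)
    have hx' := hx
    rw [hFA] at hx'
    obtain ⟨a, -, hax⟩ := Submodule.mem_span_finset.1 hx'
    have hax' : ∑ v ∈ A, (a v : ℝ) • v = x := hax
    -- A facet functional extracts one coordinate from a linear combination of vertices.
    have hcoord : ∀ v ∈ A, ∀ b : E → ℝ, l v (∑ u ∈ A, b u • u) = b v * l v v := by
      intro v hv b
      rw [map_sum, Finset.sum_eq_single_of_mem v hv]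
      · simp
      · intro u hu huv
        rw [map_smul, hlu v (Finset.mem_filter.1 hv).1 u (Finset.mem_filter.1 hu).1 huv, smul_zero]
    have hev : ∀ v ∈ A, ∀ᶠ t in 𝓝[>] (0 : ℝ), 0 ≤ a v + t * c v := by
      intro v hv
      have hvV := (Finset.mem_filter.1 hv).1
      rcases (a v).2.eq_or_lt with h0 | h0
      · have hlx : l v x = 0 := by
          rw [← hax', hcoord v hv fun u => (a u : ℝ)]
          exact mul_eq_zero_of_left h0.symm _
        have hlw := (PointedCone.convex _).nonneg_of_mem_posTangentConeAt (hF.le hx) (l v)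
          (fun y hy => PointedCone.nonneg_of_mem_hull (hl v hvV) hy) hlx hw
        rw [hcoord v hv c] at hlw
        have hc : 0 ≤ c v := nonneg_of_mul_nonneg_left hlw (hlv v hvV)
        filter_upwards [self_mem_nhdsWithin] with t ht
        have ht : 0 < t := ht
        exact add_nonneg (a v).2 (by positivity)
      · have hcont : Tendsto (fun t : ℝ => (a v : ℝ) + t * c v) (𝓝[>] 0) (𝓝 (a v : ℝ)) := by
          have : Continuous fun t : ℝ => (a v : ℝ) + t * c v := by fun_prop
          simpa using (this.tendsto 0).mono_left nhdsWithin_le_nhds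
        filter_upwards [hcont.eventually (lt_mem_nhds h0)] with t ht using ht.le
    obtain ⟨t, ht, htpos⟩ := ((Finset.eventually_all A).2 hev |>.and self_mem_nhdsWithin).exists
    refine F.convex.mem_posTangentConeAt hx htpos ?_
    rw [← hax', Finset.smul_sum, ← Finset.sum_add_distrib]
    refine F.sum_mem fun v hv => ?_
    rw [smul_smul, ← add_smul]
    exact F.smul_mem (ht v hv) (Finset.mem_filter.1 hv).2.2
  · exact fun w hw => ⟨posTangentConeAt_mono hF.le hw, F.convex.posTangentConeAt_subset_span hx hw⟩

end Simplex

/-! ### Nonnegative polynomials on the two arcs -/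

/-- The right end point of the parameter interval of the parabola. -/
noncomputable def parabolaEnd : ℝ := (2 + √7) / 3

theorem parabolaEnd_sq : 3 * parabolaEnd ^ 2 = 4 * parabolaEnd + 1 := by
  have h : √7 ^ 2 = 7 := Real.sq_sqrt (by norm_num)
  unfold parabolaEnd
  linear_combination h / 3

theorem four_thirds_lt_parabolaEnd : 4 / 3 < parabolaEnd := by
  have h : 2 < √7 := Real.lt_sqrt_of_sq_lt (by norm_num)
  unfold parabolaEnd
  linarith

theorem parabolaEnd_pos : 0 < parabolaEnd := by linarith [four_thirds_lt_parabolaEnd]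

theorem parabolaEnd_lt_two : parabolaEnd < 2 := by
  have h : √7 < 4 := (Real.sqrt_lt' (by norm_num)).2 (by norm_num)
  unfold parabolaEnd
  linarith

theorem nonneg_at_zero_of_nonneg_Ioc {u : ℝ → ℝ} (hu : Continuous u)
    (h : ∀ s ∈ Ioc (0 : ℝ) 1, 0 ≤ u s) : 0 ≤ u 0 := by
  refine ge_of_tendsto ((hu.tendsto 0).mono_left nhdsWithin_le_nhds : Tendsto u (𝓝[>] 0) _) ?_
  filter_upwards [Ioc_mem_nhdsGT one_pos] with s hs using h s hs

theorem HasDerivAt.eq_zero_of_nonneg_Icc {f : ℝ → ℝ} {f' p q s : ℝ} (hf : HasDerivAt f f' s)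
    (h : ∀ r ∈ Icc p q, 0 ≤ f r) (hs : s ∈ Ioo p q) (h0 : f s = 0) : f' = 0 := by
  refine IsLocalMin.hasDerivAt_eq_zero ?_ hf
  filter_upwards [Icc_mem_nhds hs.1 hs.2] with r hr
  rw [h0]
  exact h r hr

/-- A polynomial of degree three that is nonnegative on `[0, 1]` and vanishes at an interior
point has a double zero there. -/
theorem cubic_double_zero {m a b c s₀ : ℝ}
    (hf : ∀ s ∈ Icc (0 : ℝ) 1, 0 ≤ m + a * s + b * s ^ 2 + c * s ^ 3) (hs₀ : s₀ ∈ Ioo (0 : ℝ) 1)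
    (h0 : m + a * s₀ + b * s₀ ^ 2 + c * s₀ ^ 3 = 0) :
    ∃ α, m = α * s₀ ^ 2 ∧ a = c * s₀ ^ 2 - 2 * α * s₀ ∧ b = α - 2 * s₀ * c := by
  have hd : HasDerivAt (fun s : ℝ => m + a * s + b * s ^ 2 + c * s ^ 3)
      (a * 1 + b * (2 * s₀) + c * (3 * s₀ ^ 2)) s₀ := by
    have h1 := ((hasDerivAt_id' s₀).const_mul a).const_add m
    have h2 := (hasDerivAt_pow 2 s₀).const_mul b
    have h3 := (hasDerivAt_pow 3 s₀).const_mul c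
    simpa using (h1.fun_add h2).fun_add h3
  have hd0 := hd.eq_zero_of_nonneg_Icc hf hs₀ h0
  exact ⟨b + 2 * s₀ * c, by linear_combination h0 - s₀ * hd0, by linear_combination hd0, by ring⟩

/-- A polynomial of degree two that is nonnegative on `[0, q]` and vanishes at an interior
point has a double zero there. -/
theorem quadratic_double_zero {m a b q t₀ : ℝ}
    (hh : ∀ t ∈ Icc (0 : ℝ) q, 0 ≤ m + a * t - b * t ^ 2) (ht₀ : t₀ ∈ Ioo (0 : ℝ) q)
    (h0 : m + a * t₀ - b * t₀ ^ 2 = 0) : m = -b * t₀ ^ 2 ∧ a = 2 * b * t₀ := by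
  have hd : HasDerivAt (fun t : ℝ => m + a * t - b * t ^ 2) (a * 1 - b * (2 * t₀)) t₀ := by
    have h1 := ((hasDerivAt_id' t₀).const_mul a).const_add m
    have h2 := (hasDerivAt_pow 2 t₀).const_mul b
    simpa using h1.fun_sub h2
  have hd0 := hd.eq_zero_of_nonneg_Icc hh ht₀ h0
  exact ⟨by linear_combination h0 - t₀ * hd0, by linear_combination hd0⟩

/-- The tangency between the two arcs: if a functional supports both arcs, does not vanish at the
origin and touches the cubic at an interior parameter `s₀`, then it can touch the parabola only
at the parameter `parabolaEnd * s₀`. -/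
theorem eq_of_cubic_interior_zero {m a b c s₀ : ℝ} (hm : 0 < m)
    (hf : ∀ s ∈ Icc (0 : ℝ) 1, 0 ≤ m + a * s + b * s ^ 2 + c * s ^ 3)
    (hh : ∀ t ∈ Icc (0 : ℝ) parabolaEnd, 0 ≤ m + a * t - b * t ^ 2)
    (hs₀ : s₀ ∈ Ioo (0 : ℝ) 1) (h0 : m + a * s₀ + b * s₀ ^ 2 + c * s₀ ^ 3 = 0) :
    (∀ s ∈ Icc (0 : ℝ) 1, m + a * s + b * s ^ 2 + c * s ^ 3 = 0 → s = s₀) ∧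
      ∀ t ∈ Icc (0 : ℝ) parabolaEnd, m + a * t - b * t ^ 2 = 0 → t = parabolaEnd * s₀ := by
  obtain ⟨α, rfl, rfl, rfl⟩ := cubic_double_zero hf hs₀ h0
  have hT := parabolaEnd_sq
  have hT0 := parabolaEnd_pos
  set T := parabolaEnd
  obtain ⟨hs0, hs1⟩ := hs₀
  have hα : 0 < α := pos_of_mul_pos_left hm (sq_nonneg s₀)
  -- The nonnegativity at `T * s₀` bounds `c` from below; `T` is the parameter where this bound
  -- is sharpest, so that a perfect square splits off.
  have key : ∀ t, T ^ 2 * (α * s₀ ^ 2 + (c * s₀ ^ 2 - 2 * α * s₀) * t - (α - 2 * s₀ * c) * t ^ 2) =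
      α * (t - T * s₀) ^ 2 + (2 * T ^ 2 * (c * s₀) - α * (T ^ 2 + 1)) * (s₀ * t + 2 * t ^ 2) / 2 := by
    intro t
    linear_combination (-(α * s₀ * t) / 2) * hT
  have hc : 0 ≤ 2 * T ^ 2 * (c * s₀) - α * (T ^ 2 + 1) := by
    have h1 := mul_nonneg (sq_nonneg T) (hh (T * s₀) ⟨by positivity, by nlinarith⟩)
    rw [key] at h1
    have h2 : 0 < s₀ * (T * s₀) + 2 * (T * s₀) ^ 2 := by positivity
    refine nonneg_of_mul_nonneg_left (b := s₀ * (T * s₀) + 2 * (T * s₀) ^ 2) ?_ h2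
    linarith
  have hc0 : 0 < c := by
    have : 0 < c * (2 * T ^ 2 * s₀) := by nlinarith [mul_pos hα (by positivity : 0 < T ^ 2 + 1)]
    exact pos_of_mul_pos_left this (by positivity)
  constructor
  · rintro s ⟨hs, -⟩ h
    have h' : (s - s₀) ^ 2 * (α + c * s) = 0 := by linear_combination h
    rcases mul_eq_zero.1 h' with h' | h'
    · exact sub_eq_zero.1 (pow_eq_zero_iff two_ne_zero |>.1 h')
    · have : 0 < α + c * s := by positivity
      exact absurd h' this.ne'
  · rintro t ⟨ht, -⟩ h
    have h1 := key t
    rw [h, mul_zero] at h1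
    have h2 : 0 ≤ (2 * T ^ 2 * (c * s₀) - α * (T ^ 2 + 1)) * (s₀ * t + 2 * t ^ 2) / 2 := by
      have := mul_nonneg hc (by positivity : 0 ≤ s₀ * t + 2 * t ^ 2)
      linarith
    have h3 : α * (t - T * s₀) ^ 2 = 0 := le_antisymm (by linarith) (by positivity)
    have h4 := (mul_eq_zero.1 h3).resolve_left hα.ne'
    exact sub_eq_zero.1 (pow_eq_zero_iff two_ne_zero |>.1 h4)

/-- If a functional supports both arcs and touches the parabola at an interior parameter, then it
does not touch the cubic at the parameter `1`: this is where the value of `parabolaEnd` matters. -/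
theorem ne_zero_of_parabola_interior_zero {m a b c t₀ : ℝ} (hm : 0 < m)
    (hf : ∀ s ∈ Icc (0 : ℝ) 1, 0 ≤ m + a * s + b * s ^ 2 + c * s ^ 3)
    (hh : ∀ t ∈ Icc (0 : ℝ) parabolaEnd, 0 ≤ m + a * t - b * t ^ 2)
    (ht₀ : t₀ ∈ Ioo (0 : ℝ) parabolaEnd) (h0 : m + a * t₀ - b * t₀ ^ 2 = 0) :
    m + a * 1 + b * 1 ^ 2 + c * 1 ^ 3 ≠ 0 := by
  intro h1
  obtain ⟨rfl, rfl⟩ := quadratic_double_zero hh ht₀ h0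
  have hT := parabolaEnd_sq
  have hT1 := four_thirds_lt_parabolaEnd
  obtain ⟨ht0, htT⟩ := ht₀
  have hb : 0 < -b := pos_of_mul_pos_left hm (sq_nonneg t₀)
  -- The cubic is nonnegative and vanishes at the end point `1`, so its slope there is at most zero.
  have hslope : 0 ≤ -(2 * b * t₀ + 2 * b + 3 * c) := by
    have := nonneg_at_zero_of_nonneg_Ioc
      (u := fun r => -(2 * b * t₀ + 2 * b + 3 * c) + r * (b + 3 * c) - r ^ 2 * c)
      (by fun_prop) fun r hr => by
        have h2 := hf (1 - r) ⟨by linarith [hr.2], by linarith [hr.1]⟩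
        refine nonneg_of_mul_nonneg_right (a := r) ?_ hr.1
        linarith
    simpa using this
  have h3 : 0 ≤ (-b) * (3 * t₀ ^ 2 - 4 * t₀ - 1) := by linarith
  have h4 : 0 ≤ 3 * t₀ ^ 2 - 4 * t₀ - 1 := nonneg_of_mul_nonneg_right h3 hb
  nlinarith [mul_pos (sub_pos.2 htT) (by linarith : 0 < 3 * t₀ + 3 * parabolaEnd - 4)]

/-- The possible contact sets of a supporting functional with the two arcs. -/
theorem contact_set_cases {m a b c : ℝ} (hne : ¬ (m = 0 ∧ a = 0 ∧ b = 0 ∧ c = 0))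
    (hf : ∀ s ∈ Icc (0 : ℝ) 1, 0 ≤ m + a * s + b * s ^ 2 + c * s ^ 3)
    (hh : ∀ t ∈ Icc (0 : ℝ) parabolaEnd, 0 ≤ m + a * t - b * t ^ 2) :
    (∀ s ∈ Icc (0 : ℝ) 1, m + a * s + b * s ^ 2 + c * s ^ 3 = 0 → s = 0) ∨
    ((∀ s ∈ Icc (0 : ℝ) 1, m + a * s + b * s ^ 2 + c * s ^ 3 = 0 → s = 0 ∨ s = 1) ∧
      ∀ t ∈ Icc (0 : ℝ) parabolaEnd, m + a * t - b * t ^ 2 = 0 → t = 0 ∨ t = parabolaEnd) ∨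
    (∃ s₀ ∈ Ioo (0 : ℝ) 1,
      (∀ s ∈ Icc (0 : ℝ) 1, m + a * s + b * s ^ 2 + c * s ^ 3 = 0 → s = 0 ∨ s = s₀) ∧
      ∀ t ∈ Icc (0 : ℝ) parabolaEnd, m + a * t - b * t ^ 2 = 0 → t = 0) ∨
    ∃ s₀ ∈ Ioo (0 : ℝ) 1,
      (∀ s ∈ Icc (0 : ℝ) 1, m + a * s + b * s ^ 2 + c * s ^ 3 = 0 → s = s₀) ∧
      ∀ t ∈ Icc (0 : ℝ) parabolaEnd, m + a * t - b * t ^ 2 = 0 → t = parabolaEnd * s₀ := by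
  have hT0 := parabolaEnd_pos
  have hm : 0 ≤ m := by simpa using hf 0 (by simp)
  rcases hm.eq_or_lt with rfl | hm
  · have ha : 0 ≤ a := by
      have := nonneg_at_zero_of_nonneg_Ioc (u := fun s => a + b * s + c * s ^ 2)
        (by fun_prop) fun s hs => by
          refine nonneg_of_mul_nonneg_right (a := s) ?_ hs.1
          linarith [hf s ⟨hs.1.le, hs.2⟩]
      simpa using this
    rcases ha.eq_or_lt with rfl | ha
    · left
      have hb : 0 ≤ b := by
        have := nonneg_at_zero_of_nonneg_Ioc (u := fun s => b + c * s)
          (by fun_prop) fun s hs => by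
            refine nonneg_of_mul_nonneg_right (a := s ^ 2) ?_ (pow_pos hs.1 2)
            linarith [hf s ⟨hs.1.le, hs.2⟩]
        simpa using this
      have hb' : b ≤ 0 := by
        by_contra! h
        have h1 := hh parabolaEnd ⟨hT0.le, le_rfl⟩
        have h2 : 0 < b * parabolaEnd ^ 2 := by positivity
        linarith
      obtain rfl : b = 0 := le_antisymm hb' hb
      intro s _ h
      have h' : c * s ^ 3 = 0 := by linarith
      rcases mul_eq_zero.1 h' with h' | h'
      · exact absurd ⟨rfl, rfl, rfl, h'⟩ hne
      · exact pow_eq_zero_iff three_ne_zero |>.1 h'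
    · right
      by_cases hex : ∃ s₀ ∈ Ioo (0 : ℝ) 1, 0 + a * s₀ + b * s₀ ^ 2 + c * s₀ ^ 3 = 0
      · right; left
        obtain ⟨s₀, hs₀, h0⟩ := hex
        refine ⟨s₀, hs₀, ?_⟩
        obtain ⟨α, hα, rfl, rfl⟩ := cubic_double_zero hf hs₀ h0
        obtain rfl : α = 0 := (mul_eq_zero.1 hα.symm).resolve_right (pow_pos hs₀.1 2).ne'
        have hs0 := hs₀.1
        have hc : 0 < c := pos_of_mul_pos_left (by linarith : 0 < c * s₀ ^ 2) (sq_nonneg s₀)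
        constructor
        · intro s _ h
          have h' : c * s * (s - s₀) ^ 2 = 0 := by linear_combination h
          rcases mul_eq_zero.1 h' with h' | h'
          · exact Or.inl ((mul_eq_zero.1 h').resolve_left hc.ne')
          · exact Or.inr (sub_eq_zero.1 (pow_eq_zero_iff two_ne_zero |>.1 h'))
        · rintro t ⟨ht, -⟩ h
          have h' : t * (c * s₀ ^ 2 + 2 * s₀ * c * t) = 0 := by linear_combination h
          have : 0 < c * s₀ ^ 2 + 2 * s₀ * c * t := by positivity
          exact (mul_eq_zero.1 h').resolve_right this.ne'
      · left
        push Not at hex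
        constructor
        · rintro s ⟨hs0, hs1⟩ h
          by_contra! hs
          exact hex s ⟨lt_of_le_of_ne hs0 hs.1.symm, lt_of_le_of_ne hs1 hs.2⟩ h
        · rintro t ⟨ht0, htT⟩ h
          by_contra! ht
          have htT := lt_of_le_of_ne htT ht.2
          have ht0 := lt_of_le_of_ne ht0 ht.1.symm
          have h1 : a = b * t := by
            refine mul_left_cancel₀ ht.1 ?_
            linear_combination h
          have hb : 0 < b := pos_of_mul_pos_left (h1 ▸ ha) ht0.le
          have h2 : 0 ≤ parabolaEnd * (b * (t - parabolaEnd)) := by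
            have := hh parabolaEnd ⟨hT0.le, le_rfl⟩
            rw [h1] at this
            linarith
          have h3 := nonneg_of_mul_nonneg_right h2 hT0
          have h4 := nonneg_of_mul_nonneg_right h3 hb
          linarith
  · right
    by_cases hex : ∃ s₀ ∈ Ioo (0 : ℝ) 1, m + a * s₀ + b * s₀ ^ 2 + c * s₀ ^ 3 = 0
    · right; right
      obtain ⟨s₀, hs₀, h0⟩ := hex
      exact ⟨s₀, hs₀, eq_of_cubic_interior_zero hm hf hh hs₀ h0⟩
    · push Not at hex
      by_cases hex' : ∃ t₀ ∈ Ioo (0 : ℝ) parabolaEnd, m + a * t₀ - b * t₀ ^ 2 = 0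
      · right; right
        obtain ⟨t₀, ht₀, h0⟩ := hex'
        refine ⟨t₀ / parabolaEnd, ⟨div_pos ht₀.1 hT0, (div_lt_one hT0).2 ht₀.2⟩, ?_, ?_⟩
        · rintro s ⟨hs0, hs1⟩ h
          exfalso
          rcases hs0.eq_or_lt with rfl | hs0
          · simp at h
            exact hm.ne' h
          rcases hs1.eq_or_lt with rfl | hs1
          · exact ne_zero_of_parabola_interior_zero hm hf hh ht₀ h0 h
          · exact hex s ⟨hs0, hs1⟩ h
        · intro t _ h
          rw [mul_div_cancel₀ _ hT0.ne']
          obtain ⟨rfl, rfl⟩ := quadratic_double_zero hh ht₀ h0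
          have hb : 0 < -b := pos_of_mul_pos_left hm (sq_nonneg t₀)
          have h' : (-b) * (t - t₀) ^ 2 = 0 := by linear_combination h
          have h2 := (mul_eq_zero.1 h').resolve_left hb.ne'
          exact sub_eq_zero.1 (pow_eq_zero_iff two_ne_zero |>.1 h2)
      · left
        push Not at hex'
        constructor
        · rintro s ⟨hs0, hs1⟩ h
          by_contra! hs
          exact hex s ⟨lt_of_le_of_ne hs0 hs.1.symm, lt_of_le_of_ne hs1 hs.2⟩ h
        · rintro t ⟨ht0, htT⟩ h
          by_contra! ht
          exact hex' t ⟨lt_of_le_of_ne ht0 ht.1.symm, lt_of_le_of_ne htT ht.2⟩ h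

/-! ### The cone over the two arcs -/

/-- The point `(γ₁(s), 1)` of the cubic arc, lifted to `ℝ⁴`. -/
noncomputable def cubicRay (s : ℝ) : EuclideanSpace ℝ (Fin 4) := !₂[-s, -s ^ 2, -s ^ 3, 1]

/-- The point `(γ₂(t), 1)` of the parabola, lifted to `ℝ⁴`. -/
noncomputable def parabolaRay (t : ℝ) : EuclideanSpace ℝ (Fin 4) := !₂[-t, t ^ 2, 0, 1]

/-- The generators of the cone `cubicCone`: the two arcs lifted to `ℝ⁴`. -/
noncomputable def arcRays : Set (EuclideanSpace ℝ (Fin 4)) :=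
  cubicRay '' Icc 0 1 ∪ parabolaRay '' Icc 0 parabolaEnd

theorem cubicRay_mem {s : ℝ} (hs : s ∈ Icc (0 : ℝ) 1) : cubicRay s ∈ arcRays :=
  Or.inl (mem_image_of_mem _ hs)

theorem parabolaRay_mem {t : ℝ} (ht : t ∈ Icc (0 : ℝ) parabolaEnd) : parabolaRay t ∈ arcRays :=
  Or.inr (mem_image_of_mem _ ht)

theorem zero_mem_parabola : (0 : ℝ) ∈ Icc (0 : ℝ) parabolaEnd := ⟨le_rfl, parabolaEnd_pos.le⟩

@[simp] theorem cubicRay_inj {s s' : ℝ} : cubicRay s = cubicRay s' ↔ s = s' := by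
  refine ⟨fun h => ?_, fun h => h ▸ rfl⟩
  have := congrArg (fun x : EuclideanSpace ℝ (Fin 4) => x 0) h
  simpa [cubicRay] using this

@[simp] theorem parabolaRay_inj {t t' : ℝ} : parabolaRay t = parabolaRay t' ↔ t = t' := by
  refine ⟨fun h => ?_, fun h => h ▸ rfl⟩
  have := congrArg (fun x : EuclideanSpace ℝ (Fin 4) => x 0) h
  simpa [parabolaRay] using this

@[simp] theorem cubicRay_eq_parabolaRay {s t : ℝ} : cubicRay s = parabolaRay t ↔ s = 0 ∧ t = 0 := by
  constructor
  · intro h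
    have h2 := congrArg (fun x : EuclideanSpace ℝ (Fin 4) => x 2) h
    have h0 := congrArg (fun x : EuclideanSpace ℝ (Fin 4) => x 0) h
    simp only [cubicRay, parabolaRay] at h0 h2
    simp at h0 h2
    exact ⟨h2, by rw [← h0, h2]⟩
  · rintro ⟨rfl, rfl⟩
    simp [cubicRay, parabolaRay]

theorem cubicCone_eq_hull : cubicCone = (PointedCone.hull ℝ arcRays : Set _) := by
  have himg : ∀ x ∈ cubicArc ∪ parabolaArc,
      (!₂[x 0, x 1, x 2, 1] : EuclideanSpace ℝ (Fin 4)) ∈ arcRays := by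
    rintro x (⟨s, hs, rfl⟩ | ⟨t, ht, rfl⟩)
    · exact Or.inl ⟨s, hs, by simp [cubicRay]⟩
    · exact Or.inr ⟨t, ht, by simp [parabolaRay]⟩
  have hsub : ∀ g ∈ arcRays, g ∈ (fun x : EuclideanSpace ℝ (Fin 3) =>
      (!₂[x 0, x 1, x 2, 1] : EuclideanSpace ℝ (Fin 4))) '' cubicBody := by
    rintro g (⟨s, hs, rfl⟩ | ⟨t, ht, rfl⟩)
    · exact ⟨!₂[-s, -s ^ 2, -s ^ 3], subset_convexHull ℝ _ (Or.inl ⟨s, hs, rfl⟩),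
        by simp [cubicRay]⟩
    · exact ⟨!₂[-t, t ^ 2, 0], subset_convexHull ℝ _ (Or.inr ⟨t, ht, rfl⟩),
        by simp [parabolaRay]⟩
  unfold cubicCone homogenization
  congr 1
  apply le_antisymm
  · refine Submodule.span_le.2 ?_
    rintro _ ⟨x, hx, rfl⟩
    refine convexHull_min (t := {x : EuclideanSpace ℝ (Fin 3) |
      (!₂[x 0, x 1, x 2, 1] : EuclideanSpace ℝ (Fin 4)) ∈ PointedCone.hull ℝ arcRays})
      (fun y hy => Submodule.subset_span (himg y hy)) ?_ hx
    intro u hu v hv a b ha hb hab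
    have h := (PointedCone.hull ℝ arcRays).convex hu hv ha hb hab
    rw [mem_ofPred_eq]
    convert SetLike.mem_coe.1 h using 2
    ext i
    fin_cases i <;> simp [hab]
  · exact Submodule.span_mono hsub

/-- The linear functional on `ℝ⁴` that restricts to `m + a s + b s² + c s³` on the cubic and to
`m + a t - b t²` on the parabola. -/
noncomputable def arcFunctional (m a b c : ℝ) : EuclideanSpace ℝ (Fin 4) →L[ℝ] ℝ :=
  m • EuclideanSpace.proj 3 - a • EuclideanSpace.proj 0 - b • EuclideanSpace.proj 1 -
    c • EuclideanSpace.proj 2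

theorem arcFunctional_apply (m a b c : ℝ) (x : EuclideanSpace ℝ (Fin 4)) :
    arcFunctional m a b c x = m * x 3 - a * x 0 - b * x 1 - c * x 2 := by
  simp [arcFunctional]

theorem arcFunctional_cubicRay (m a b c s : ℝ) :
    arcFunctional m a b c (cubicRay s) = m + a * s + b * s ^ 2 + c * s ^ 3 := by
  simp [arcFunctional_apply, cubicRay]

theorem arcFunctional_parabolaRay (m a b c t : ℝ) :
    arcFunctional m a b c (parabolaRay t) = m + a * t - b * t ^ 2 := by
  simp [arcFunctional_apply, parabolaRay]

theorem exists_eq_arcFunctional (l : EuclideanSpace ℝ (Fin 4) →L[ℝ] ℝ) :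
    ∃ m a b c, l = arcFunctional m a b c := by
  refine ⟨l (EuclideanSpace.single 3 1), -l (EuclideanSpace.single 0 1),
    -l (EuclideanSpace.single 1 1), -l (EuclideanSpace.single 2 1), ?_⟩
  ext x
  have hx : x = x 0 • EuclideanSpace.single 0 (1 : ℝ) + x 1 • EuclideanSpace.single 1 (1 : ℝ) +
      x 2 • EuclideanSpace.single 2 (1 : ℝ) + x 3 • EuclideanSpace.single 3 (1 : ℝ) := by
    ext i
    fin_cases i <;> simp
  rw [arcFunctional_apply]
  nth_rw 1 [hx]
  simp only [map_add, map_smul, smul_eq_mul]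
  ring

theorem arcFunctional_nonneg {m a b c : ℝ}
    (hf : ∀ s ∈ Icc (0 : ℝ) 1, 0 ≤ m + a * s + b * s ^ 2 + c * s ^ 3)
    (hh : ∀ t ∈ Icc (0 : ℝ) parabolaEnd, 0 ≤ m + a * t - b * t ^ 2) :
    ∀ g ∈ arcRays, 0 ≤ arcFunctional m a b c g := by
  rintro g (⟨s, hs, rfl⟩ | ⟨t, ht, rfl⟩)
  · rw [arcFunctional_cubicRay]; exact hf s hs
  · rw [arcFunctional_parabolaRay]; exact hh t ht

/-! ### The simplicial faces of the cone -/

/-- The functional `s (s - s₀)²`, exposing the segment from the origin to the cubic. -/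
theorem originEdge_nonneg {s₀ : ℝ} (hs₀ : 0 < s₀) :
    ∀ g ∈ arcRays, 0 ≤ arcFunctional 0 (s₀ ^ 2) (-2 * s₀) 1 g := by
  refine arcFunctional_nonneg (fun s hs => ?_) fun t ht => ?_
  · have := mul_nonneg hs.1 (sq_nonneg (s - s₀))
    linarith
  · have := ht.1
    have : 0 ≤ s₀ ^ 2 * t + 2 * s₀ * t ^ 2 := by positivity
    linarith

theorem ruling_cubic_identity {s₀ : ℝ} (hs₀ : 0 < s₀) (s : ℝ) :
    parabolaEnd ^ 2 * s₀ ^ 2 + -2 * parabolaEnd * s₀ * s + -1 * s ^ 2 +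
      (parabolaEnd ^ 2 + 1) / (2 * s₀) * s ^ 3 =
    (s - s₀) ^ 2 * (parabolaEnd ^ 2 + (parabolaEnd ^ 2 + 1) / (2 * s₀) * s) := by
  field_simp
  linear_combination (s₀ ^ 2 * s) * parabolaEnd_sq

/-- The functional that restricts to `(t - parabolaEnd * s₀)²` on the parabola and has a double
zero at `s₀` on the cubic. It exposes an edge of the ruled part of the boundary. -/
theorem ruling_nonneg {s₀ : ℝ} (hs₀ : 0 < s₀) :
    ∀ g ∈ arcRays, 0 ≤ arcFunctional (parabolaEnd ^ 2 * s₀ ^ 2) (-2 * parabolaEnd * s₀) (-1)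
      ((parabolaEnd ^ 2 + 1) / (2 * s₀)) g := by
  refine arcFunctional_nonneg (fun s hs => ?_) fun t _ => ?_
  · rw [ruling_cubic_identity hs₀]
    have := hs.1
    positivity
  · have := sq_nonneg (t - parabolaEnd * s₀)
    linarith

/-- The functional `-z`, exposing the planar face spanned by the parabola. -/
theorem planar_nonneg : ∀ g ∈ arcRays, 0 ≤ arcFunctional 0 0 0 1 g := by
  refine arcFunctional_nonneg (fun s hs => ?_) fun t ht => by simp
  have := pow_nonneg hs.1 3
  linarith

theorem isExposedSimplex_originEdge {s₀ : ℝ} (hs₀ : s₀ ∈ Ioo (0 : ℝ) 1) :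
    IsExposedSimplex arcRays {parabolaRay 0, cubicRay s₀} := by
  have h0 := hs₀.1
  refine ⟨⟨arcFunctional 0 (s₀ ^ 2) (-2 * s₀) 1, originEdge_nonneg h0, ?_⟩, ?_⟩
  · rintro g (⟨s, hs, rfl⟩ | ⟨t, ht, rfl⟩)
    · have : 0 + s₀ ^ 2 * s + -2 * s₀ * s ^ 2 + 1 * s ^ 3 = s * (s - s₀) ^ 2 := by ring
      rw [arcFunctional_cubicRay, this]
      simp [sub_eq_zero]
    · have : 0 + s₀ ^ 2 * t - -2 * s₀ * t ^ 2 = t * (s₀ ^ 2 + 2 * s₀ * t) := by ring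
      have h1 : s₀ ^ 2 + 2 * s₀ * t ≠ 0 := by
        have := ht.1
        positivity
      rw [arcFunctional_parabolaRay, this]
      simp [h1, eq_comm (a := parabolaRay t), h0.ne', eq_comm (a := t)]
  · intro v hv
    simp only [Finset.mem_insert, Finset.mem_singleton] at hv
    rcases hv with rfl | rfl
    · refine ⟨_, ruling_nonneg h0, ?_, ?_⟩
      · rw [arcFunctional_parabolaRay]
        have := parabolaEnd_pos
        have : 0 < parabolaEnd ^ 2 * s₀ ^ 2 := by positivity
        linarith
      · intro u hu hne
        simp only [Finset.mem_insert, Finset.mem_singleton] at hu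
        obtain rfl := hu.resolve_left hne
        rw [arcFunctional_cubicRay, ruling_cubic_identity h0]
        simp
    · refine ⟨_, planar_nonneg, ?_, ?_⟩
      · rw [arcFunctional_cubicRay]
        have : 0 < s₀ ^ 3 := by positivity
        linarith
      · intro u hu hne
        simp only [Finset.mem_insert, Finset.mem_singleton] at hu
        obtain rfl := hu.resolve_right hne
        simp [arcFunctional_parabolaRay]

theorem isExposedSimplex_ruling {s₀ : ℝ} (hs₀ : s₀ ∈ Ioo (0 : ℝ) 1) :
    IsExposedSimplex arcRays {cubicRay s₀, parabolaRay (parabolaEnd * s₀)} := by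
  have h0 := hs₀.1
  have hT := parabolaEnd_pos
  have hpar : ∀ t, parabolaEnd ^ 2 * s₀ ^ 2 + -2 * parabolaEnd * s₀ * t - -1 * t ^ 2 =
      (t - parabolaEnd * s₀) ^ 2 := fun t => by ring
  refine ⟨⟨_, ruling_nonneg h0, ?_⟩, ?_⟩
  · rintro g (⟨s, hs, rfl⟩ | ⟨t, ht, rfl⟩)
    · have h1 : parabolaEnd ^ 2 + (parabolaEnd ^ 2 + 1) / (2 * s₀) * s ≠ 0 := by
        have := hs.1
        positivity
      rw [arcFunctional_cubicRay, ruling_cubic_identity h0]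
      simp [h1, sub_eq_zero, h0.ne', hT.ne']
    · rw [arcFunctional_parabolaRay, hpar]
      simp [sub_eq_zero, eq_comm (a := parabolaRay t), h0.ne', eq_comm (a := t)]
  · intro v hv
    simp only [Finset.mem_insert, Finset.mem_singleton] at hv
    rcases hv with rfl | rfl
    · refine ⟨_ + _, fun g hg => add_nonneg (ruling_nonneg h0 g hg) (planar_nonneg g hg), ?_, ?_⟩
      · rw [add_apply, arcFunctional_cubicRay, arcFunctional_cubicRay,
          ruling_cubic_identity h0]
        have : 0 < s₀ ^ 3 := by positivity
        simpa using this
      · intro u hu hne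
        simp only [Finset.mem_insert, Finset.mem_singleton] at hu
        obtain rfl := hu.resolve_left hne
        rw [add_apply, arcFunctional_parabolaRay, arcFunctional_parabolaRay, hpar]
        simp
    · refine ⟨_, originEdge_nonneg h0, ?_, ?_⟩
      · rw [arcFunctional_parabolaRay]
        have : 0 < s₀ ^ 2 * (parabolaEnd * s₀) + 2 * s₀ * (parabolaEnd * s₀) ^ 2 := by positivity
        linarith
      · intro u hu hne
        simp only [Finset.mem_insert, Finset.mem_singleton] at hu
        obtain rfl := hu.resolve_right hne
        rw [arcFunctional_cubicRay]
        ring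

theorem isExposedSimplex_triangle :
    IsExposedSimplex arcRays {parabolaRay 0, cubicRay 1, parabolaRay parabolaEnd} := by
  have hT := parabolaEnd_pos
  refine ⟨⟨arcFunctional 0 parabolaEnd 1 (-(parabolaEnd + 1)), ?_, ?_⟩, ?_⟩
  · refine arcFunctional_nonneg (fun s hs => ?_) fun t ht => ?_
    · have := mul_nonneg (mul_nonneg hs.1 (sub_nonneg.2 hs.2))
        (by have := hs.1; positivity : 0 ≤ parabolaEnd + (parabolaEnd + 1) * s)
      linarith
    · have := mul_nonneg ht.1 (sub_nonneg.2 ht.2)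
      linarith
  · rintro g (⟨s, hs, rfl⟩ | ⟨t, ht, rfl⟩)
    · have : 0 + parabolaEnd * s + 1 * s ^ 2 + -(parabolaEnd + 1) * s ^ 3 =
        s * (1 - s) * (parabolaEnd + (parabolaEnd + 1) * s) := by ring
      have h1 : parabolaEnd + (parabolaEnd + 1) * s ≠ 0 := by
        have := hs.1
        positivity
      rw [arcFunctional_cubicRay, this]
      simp [h1, sub_eq_zero, hT.ne', eq_comm (a := (1 : ℝ))]
    · have : 0 + parabolaEnd * t - 1 * t ^ 2 = t * (parabolaEnd - t) := by ring
      rw [arcFunctional_parabolaRay, this]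
      simp [sub_eq_zero, eq_comm (a := parabolaRay t), eq_comm (a := t)]
  · intro v hv
    simp only [Finset.mem_insert, Finset.mem_singleton] at hv
    rcases hv with rfl | rfl | rfl
    · refine ⟨_, ruling_nonneg one_pos, ?_, ?_⟩
      · rw [arcFunctional_parabolaRay]
        have : 0 < parabolaEnd ^ 2 := by positivity
        linarith
      · intro u hu hne
        simp only [Finset.mem_insert, Finset.mem_singleton] at hu
        rcases hu.resolve_left hne with rfl | rfl
        · rw [arcFunctional_cubicRay, ruling_cubic_identity one_pos]
          simp
        · rw [arcFunctional_parabolaRay]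
          ring
    · refine ⟨arcFunctional 0 parabolaEnd 1 0, ?_, ?_, ?_⟩
      · refine arcFunctional_nonneg (fun s hs => ?_) fun t ht => ?_
        · have := hs.1
          positivity
        · have := mul_nonneg ht.1 (sub_nonneg.2 ht.2)
          linarith
      · rw [arcFunctional_cubicRay]
        positivity
      · intro u hu hne
        simp only [Finset.mem_insert, Finset.mem_singleton] at hu
        rcases hu with rfl | rfl | rfl
        · simp [arcFunctional_parabolaRay]
        · exact absurd rfl hne
        · rw [arcFunctional_parabolaRay]
          ring
    · refine ⟨_, originEdge_nonneg one_pos, ?_, ?_⟩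
      · rw [arcFunctional_parabolaRay]
        have : 0 < parabolaEnd + 2 * parabolaEnd ^ 2 := by positivity
        linarith
      · intro u hu hne
        simp only [Finset.mem_insert, Finset.mem_singleton] at hu
        rcases hu with rfl | rfl | rfl
        · simp [arcFunctional_parabolaRay]
        · rw [arcFunctional_cubicRay]
          ring
        · exact absurd rfl hne

/-! ### Classification of the faces -/

theorem interior_hull_arcRays_nonempty :
    (interior (PointedCone.hull ℝ arcRays : Set (EuclideanSpace ℝ (Fin 4)))).Nonempty := by
  rw [(PointedCone.convex _).interior_nonempty_iff_affineSpan_eq_top,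
    AffineSubspace.affineSpan_eq_top_iff_vectorSpan_eq_top_of_nonempty _ _ _ ⟨0, zero_mem _⟩]
  by_contra hne
  obtain ⟨φ, hφ, hφ0⟩ := Submodule.exists_dual_map_eq_bot_of_lt_top (lt_top_iff_ne_top.2 hne)
    inferInstance
  have hvan : ∀ g ∈ arcRays, φ g = 0 := by
    intro g hg
    have h1 : g ∈ vectorSpan ℝ (PointedCone.hull ℝ arcRays : Set (EuclideanSpace ℝ (Fin 4))) := by
      have := vsub_mem_vectorSpan ℝ (Submodule.subset_span hg : g ∈ PointedCone.hull ℝ arcRays)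
        (zero_mem (PointedCone.hull ℝ arcRays))
      simpa using this
    have h2 := Submodule.mem_map_of_mem (f := φ) h1
    rw [hφ0] at h2
    simpa using h2
  obtain ⟨m, a, b, c, hl⟩ := exists_eq_arcFunctional (LinearMap.toContinuousLinearMap φ)
  have hvan' : ∀ g ∈ arcRays, arcFunctional m a b c g = 0 := fun g hg => by
    rw [← hl]; exact hvan g hg
  have h1 := hvan' _ (parabolaRay_mem zero_mem_parabola)
  have h2 := hvan' _ (parabolaRay_mem (t := 1)
    ⟨zero_le_one, by linarith [four_thirds_lt_parabolaEnd]⟩)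
  have h3 := hvan' _ (cubicRay_mem (s := 1) (by norm_num))
  have h4 := hvan' _ (cubicRay_mem (s := 1 / 2) (by norm_num))
  rw [arcFunctional_parabolaRay] at h1 h2
  rw [arcFunctional_cubicRay] at h3 h4
  norm_num at h1 h2 h3 h4
  obtain rfl : m = 0 := h1
  obtain rfl : a = 0 := by linarith
  obtain rfl : b = 0 := by linarith
  obtain rfl : c = 0 := by linarith
  apply hφ
  ext x
  have h5 := congrArg (fun l => l x) hl
  simpa [arcFunctional_apply] using h5

variable {F : PointedCone ℝ (EuclideanSpace ℝ (Fin 4))}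

/-- Two crossing chords of the parabola: a third divided difference annihilates polynomials of
degree two, and its weights alternate in sign. -/
theorem parabolaRay_crossing (a b c d : ℝ) :
    ((c - b) * (d - b) * (d - c)) • parabolaRay a + ((b - a) * (d - a) * (d - b)) • parabolaRay c =
      ((c - a) * (d - a) * (d - c)) • parabolaRay b +
        ((b - a) * (c - a) * (c - b)) • parabolaRay d := by
  ext i
  fin_cases i <;> simp [parabolaRay] <;> ring

theorem parabolaRay_mem_hull {t : ℝ} (ht : t ∈ Icc (0 : ℝ) parabolaEnd) :
    parabolaRay t ∈ PointedCone.hull ℝ arcRays :=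
  Submodule.subset_span (parabolaRay_mem ht)

/-- A face that contains two points of the parabola, other than both end points, contains the
whole parabola. -/
theorem PointedCone.IsFaceOf.parabolaRay_mem_of_two
    (hF : F.IsFaceOf (PointedCone.hull ℝ arcRays)) {t₁ t₂ : ℝ} (h0 : 0 ≤ t₁) (hlt : t₁ < t₂)
    (hT : t₂ ≤ parabolaEnd) (h₁ : parabolaRay t₁ ∈ F) (h₂ : parabolaRay t₂ ∈ F)
    (hne : ¬ (t₁ = 0 ∧ t₂ = parabolaEnd)) :
    ∀ t ∈ Icc (0 : ℝ) parabolaEnd, parabolaRay t ∈ F := by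
  have right : ∀ a b c d : ℝ, 0 ≤ a → a < b → b < c → c < d → d ≤ parabolaEnd →
      parabolaRay a ∈ F → parabolaRay c ∈ F → parabolaRay b ∈ F ∧ parabolaRay d ∈ F := by
    intro a b c d ha hab hbc hcd hd hFa hFc
    have hab' := sub_pos.2 hab
    have hbc' := sub_pos.2 hbc
    have hcd' := sub_pos.2 hcd
    have hac' := sub_pos.2 (hab.trans hbc)
    have hbd' := sub_pos.2 (hbc.trans hcd)
    have had' := sub_pos.2 (hab.trans (hbc.trans hcd))
    have hmem := F.add_mem
      (F.smul_mem (by positivity : 0 ≤ (c - b) * (d - b) * (d - c)) hFa)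
      (F.smul_mem (by positivity : 0 ≤ (b - a) * (d - a) * (d - b)) hFc)
    rw [parabolaRay_crossing] at hmem
    have hbK := parabolaRay_mem_hull (t := b) ⟨by linarith, by linarith⟩
    have hdK := parabolaRay_mem_hull (t := d) ⟨by linarith, hd⟩
    exact ⟨hF.mem_of_smul_add_smul_mem_left hbK hdK (by positivity) (by positivity) hmem,
      hF.mem_of_smul_add_smul_mem_right hbK hdK (by positivity) (by positivity) hmem⟩
  have left : ∀ a b c d : ℝ, 0 ≤ a → a < b → b < c → c < d → d ≤ parabolaEnd →
      parabolaRay b ∈ F → parabolaRay d ∈ F → parabolaRay a ∈ F ∧ parabolaRay c ∈ F := by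
    intro a b c d ha hab hbc hcd hd hFb hFd
    have hab' := sub_pos.2 hab
    have hbc' := sub_pos.2 hbc
    have hcd' := sub_pos.2 hcd
    have hac' := sub_pos.2 (hab.trans hbc)
    have hbd' := sub_pos.2 (hbc.trans hcd)
    have had' := sub_pos.2 (hab.trans (hbc.trans hcd))
    have hmem := F.add_mem
      (F.smul_mem (by positivity : 0 ≤ (c - a) * (d - a) * (d - c)) hFb)
      (F.smul_mem (by positivity : 0 ≤ (b - a) * (c - a) * (c - b)) hFd)
    rw [← parabolaRay_crossing] at hmem
    have haK := parabolaRay_mem_hull (t := a) ⟨ha, by linarith⟩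
    have hcK := parabolaRay_mem_hull (t := c) ⟨by linarith, by linarith⟩
    exact ⟨hF.mem_of_smul_add_smul_mem_left haK hcK (by positivity) (by positivity) hmem,
      hF.mem_of_smul_add_smul_mem_right haK hcK (by positivity) (by positivity) hmem⟩
  have hend : ∃ r, 0 < r ∧ r < parabolaEnd ∧ parabolaRay r ∈ F ∧ parabolaRay 0 ∈ F ∧
      parabolaRay parabolaEnd ∈ F := by
    have hstart : parabolaRay 0 ∈ F := by
      rcases h0.eq_or_lt with rfl | h0
      · exact h₁
      · exact (left 0 t₁ ((t₁ + t₂) / 2) t₂ le_rfl h0 (by linarith) (by linarith) hT h₁ h₂).1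
    rcases hT.eq_or_lt with rfl | hT
    · exact ⟨t₁, lt_of_le_of_ne h0 fun h => hne ⟨h.symm, rfl⟩, hlt, h₁, hstart, h₂⟩
    · exact ⟨t₂, by linarith, hT, h₂, hstart,
        (right t₁ ((t₁ + t₂) / 2) t₂ _ h0 (by linarith) (by linarith) hT le_rfl h₁ h₂).2⟩
  obtain ⟨r, hr0, hrT, hr, hF0, hFT⟩ := hend
  rintro t ⟨ht0, htT⟩
  rcases ht0.eq_or_lt with rfl | ht0
  · exact hF0
  rcases htT.eq_or_lt with rfl | htT
  · exact hFT
  rcases lt_trichotomy t r with h | rfl | h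
  · exact (right 0 t r _ le_rfl ht0 h hrT le_rfl hF0 hr).1
  · exact hr
  · exact (left 0 r t _ le_rfl hr0 h htT le_rfl hr hFT).2

theorem planar_eq_zero_iff {g : EuclideanSpace ℝ (Fin 4)} (hg : g ∈ arcRays) :
    arcFunctional 0 0 0 1 g = 0 ↔ ∃ t ∈ Icc (0 : ℝ) parabolaEnd, parabolaRay t = g := by
  rcases hg with ⟨s, hs, rfl⟩ | ⟨t, ht, rfl⟩
  · rw [arcFunctional_cubicRay]
    constructor
    · intro h
      have h' : s ^ 3 = 0 := by linarith
      exact ⟨0, zero_mem_parabola, by simpa [eq_comm (a := parabolaRay 0)] using h'⟩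
    · rintro ⟨t, -, h⟩
      simp [(cubicRay_eq_parabolaRay.1 h.symm).1]
  · exact iff_of_true (by simp [arcFunctional_parabolaRay]) ⟨t, ht, rfl⟩

/-- Every proper face is either spanned by vertices of an exposed simplex, or it is the planar
face spanned by the parabola. -/
theorem PointedCone.IsFaceOf.exists_simplex_or_planar
    (hF : F.IsFaceOf (PointedCone.hull ℝ arcRays)) (hne : F ≠ PointedCone.hull ℝ arcRays) :
    (∃ V, IsExposedSimplex arcRays V ∧ arcRays ∩ F ⊆ V) ∨
      ∀ g ∈ arcRays, arcFunctional 0 0 0 1 g = 0 ↔ g ∈ F := by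
  obtain ⟨l, hl, hlK, hlF⟩ := hF.exists_supporting hne interior_hull_arcRays_nonempty
  obtain ⟨m, a, b, c, rfl⟩ := exists_eq_arcFunctional l
  have hcub : ∀ s, cubicRay s ∈ F → m + a * s + b * s ^ 2 + c * s ^ 3 = 0 := fun s hs => by
    rw [← arcFunctional_cubicRay]; exact hlF _ hs
  have hpar : ∀ t, parabolaRay t ∈ F → m + a * t - b * t ^ 2 = 0 := fun t ht => by
    rw [← arcFunctional_parabolaRay (c := c)]; exact hlF _ ht
  have hne0 : ¬ (m = 0 ∧ a = 0 ∧ b = 0 ∧ c = 0) := by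
    rintro ⟨rfl, rfl, rfl, rfl⟩
    apply hl
    ext x
    simp [arcFunctional_apply]
  rcases contact_set_cases (m := m) (a := a) (b := b) (c := c) hne0
    (fun s hs => by
      rw [← arcFunctional_cubicRay]; exact hlK _ (Submodule.subset_span (cubicRay_mem hs)))
    (fun t ht => by
      rw [← arcFunctional_parabolaRay (c := c)]; exact hlK _ (parabolaRay_mem_hull ht))
    with h | ⟨hs, ht⟩ | ⟨s₀, hs₀, hs, ht⟩ | ⟨s₀, hs₀, hs, ht⟩
  · -- The generators in the face lie on the parabola.
    have hon : ∀ g ∈ arcRays, g ∈ F → ∃ t ∈ Icc (0 : ℝ) parabolaEnd, parabolaRay t = g := by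
      rintro g (⟨s, hs, rfl⟩ | ⟨t, ht, rfl⟩) hg
      · exact ⟨0, zero_mem_parabola, (cubicRay_eq_parabolaRay.2 ⟨h s hs (hcub s hg), rfl⟩).symm⟩
      · exact ⟨t, ht, rfl⟩
    by_cases hall : ∀ t ∈ Icc (0 : ℝ) parabolaEnd, parabolaRay t ∈ F
    · right
      intro g hg
      rw [planar_eq_zero_iff hg]
      exact ⟨fun ⟨t, ht, h⟩ => h ▸ hall t ht, hon g hg⟩
    · left
      by_cases hint : ∃ t ∈ Ioo (0 : ℝ) parabolaEnd, parabolaRay t ∈ F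
      · obtain ⟨t, ht, hFt⟩ := hint
        have hT := parabolaEnd_pos
        refine ⟨_, isExposedSimplex_ruling (s₀ := t / parabolaEnd)
          ⟨div_pos ht.1 hT, (div_lt_one hT).2 ht.2⟩, ?_⟩
        rintro g ⟨hg, hgF⟩
        obtain ⟨r, hr, rfl⟩ := hon g hg hgF
        rw [mul_div_cancel₀ _ hT.ne']
        have hrt : r = t := by
          rcases lt_trichotomy r t with hlt | heq | hlt
          · exact absurd (hF.parabolaRay_mem_of_two hr.1 hlt ht.2.le hgF hFt
              fun h => ht.2.ne h.2) hall
          · exact heq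
          · exact absurd (hF.parabolaRay_mem_of_two ht.1.le hlt hr.2 hFt hgF
              fun h => ht.1.ne' h.1) hall
        simp [hrt]
      · push Not at hint
        refine ⟨_, isExposedSimplex_triangle, ?_⟩
        rintro g ⟨hg, hgF⟩
        obtain ⟨r, hr, rfl⟩ := hon g hg hgF
        rcases hr.1.eq_or_lt with rfl | h0
        · simp
        rcases hr.2.eq_or_lt with rfl | hT
        · simp
        exact absurd hgF (hint r ⟨h0, hT⟩)
  · refine Or.inl ⟨_, isExposedSimplex_triangle, ?_⟩
    rintro g ⟨⟨s, hs', rfl⟩ | ⟨t, ht', rfl⟩, hg⟩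
    · rcases hs s hs' (hcub s hg) with rfl | rfl <;> simp
    · rcases ht t ht' (hpar t hg) with rfl | rfl <;> simp
  · refine Or.inl ⟨_, isExposedSimplex_originEdge hs₀, ?_⟩
    rintro g ⟨⟨s, hs', rfl⟩ | ⟨t, ht', rfl⟩, hg⟩
    · rcases hs s hs' (hcub s hg) with rfl | rfl <;> simp
    · rw [ht t ht' (hpar t hg)]
      simp
  · refine Or.inl ⟨_, isExposedSimplex_ruling hs₀, ?_⟩
    rintro g ⟨⟨s, hs', rfl⟩ | ⟨t, ht', rfl⟩, hg⟩
    · rw [hs s hs' (hcub s hg)]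
      simp
    · rw [ht t ht' (hpar t hg)]
      simp

theorem isFaciallyExposed_cubicCone : IsFaciallyExposed cubicCone := by
  rintro F ⟨hF, hne⟩
  rw [cubicCone_eq_hull] at hF hne ⊢
  obtain ⟨F, rfl, hF'⟩ := hF.exists_isFaceOf
  rcases hF'.exists_simplex_or_planar (fun h => hne (h ▸ rfl)) with ⟨V, hV, hFV⟩ | h
  · exact hV.isExposed hF' hFV
  · exact hF'.isExposed _ planar_nonneg h

/-! ### Tangential exposure at the planar face -/

/-- A quadratic that is nonnegative on the parabola extends to a functional supporting both arcs,
unless it vanishes to second order at the origin. -/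
theorem exists_nonneg_extension {m a b : ℝ} (hma : 0 < m ∨ m = 0 ∧ 0 < a)
    (hh : ∀ t ∈ Icc (0 : ℝ) parabolaEnd, 0 ≤ m + a * t - b * t ^ 2) :
    ∃ c, ∀ g ∈ arcRays, 0 ≤ arcFunctional m a b c g := by
  rcases hma with hm | ⟨rfl, ha⟩
  · -- For `s ≤ m / k` the constant term dominates, for `s ≥ m / k` the cubic one does.
    set k := |a| + |b| with hk
    have hk0 : 0 ≤ k := by positivity
    refine ⟨k ^ 3 / m ^ 2, arcFunctional_nonneg (fun s hs => ?_) hh⟩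
    obtain ⟨hs0, hs1⟩ := hs
    have h1 : -(k * s) ≤ a * s + b * s ^ 2 := by
      have ha := mul_nonneg (by linarith [neg_abs_le a] : 0 ≤ a + |a|) hs0
      have hb := mul_nonneg (by linarith [neg_abs_le b] : 0 ≤ b + |b|) (sq_nonneg s)
      have hs2 : |b| * s ^ 2 ≤ |b| * s :=
        mul_le_mul_of_nonneg_left (by nlinarith) (abs_nonneg b)
      rw [hk]
      linarith
    have h2 : k ^ 3 / m ^ 2 * s ^ 3 = k * s * (k * s / m) ^ 2 := by
      field_simp
    rw [h2]
    have hks : 0 ≤ k * s := mul_nonneg hk0 hs0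
    rcases le_total (k * s) m with h | h
    · have : 0 ≤ k * s * (k * s / m) ^ 2 := by positivity
      linarith
    · have h3 : 1 ≤ (k * s / m) ^ 2 := one_le_pow₀ ((one_le_div hm).2 h)
      have := mul_le_mul_of_nonneg_left h3 hks
      linarith
  · refine ⟨b ^ 2 / (4 * a), arcFunctional_nonneg (fun s hs => ?_) hh⟩
    have h1 : 0 + a * s + b * s ^ 2 + b ^ 2 / (4 * a) * s ^ 3 =
        s * (2 * a + b * s) ^ 2 / (4 * a) := by
      field_simp
      ring
    rw [h1]
    have := hs.1
    positivity

/-- The supporting functionals `y - ε x - c z`, which approximate `y` on the planar face, although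
`y - c z` is never supporting. -/
theorem exists_nonneg_perturbation {ε : ℝ} (hε : 0 < ε) :
    ∃ c, ∀ g ∈ arcRays, 0 ≤ arcFunctional 0 ε (-1) c g :=
  exists_nonneg_extension (Or.inr ⟨rfl, hε⟩) fun t ht => by
    have := mul_nonneg hε.le ht.1
    linarith [sq_nonneg t]

/-- A functional that is nonnegative on the tangent cone of the planar face extends to one
supporting the whole cone, except for multiples of `y` at the origin; these are limits of
functionals that extend. -/
theorem PointedCone.IsFaceOf.posTangentConeAt_inter_span_planar
    (hF : F.IsFaceOf (PointedCone.hull ℝ arcRays))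
    (hplanar : ∀ g ∈ arcRays, arcFunctional 0 0 0 1 g = 0 ↔ g ∈ F)
    {x : EuclideanSpace ℝ (Fin 4)} (hx : x ∈ F) :
    posTangentConeAt (PointedCone.hull ℝ arcRays : Set (EuclideanSpace ℝ (Fin 4))) x ∩
      (Submodule.span ℝ (F : Set (EuclideanSpace ℝ (Fin 4))) : Set _) =
      posTangentConeAt (F : Set (EuclideanSpace ℝ (Fin 4))) x := by
  apply Subset.antisymm
  swap
  · exact fun w hw => ⟨posTangentConeAt_mono hF.le hw, F.convex.posTangentConeAt_subset_span hx hw⟩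
  rintro w ⟨hw, hwF⟩
  have hpos : ∀ l : EuclideanSpace ℝ (Fin 4) →L[ℝ] ℝ, (∀ g ∈ arcRays, 0 ≤ l g) → l x = 0 →
      0 ≤ l w := fun l hl hlx =>
    (PointedCone.convex _).nonneg_of_mem_posTangentConeAt (hF.le hx) l
      (fun y hy => PointedCone.nonneg_of_mem_hull hl hy) hlx hw
  have hFpos : ∀ l : EuclideanSpace ℝ (Fin 4) →L[ℝ] ℝ,
      (∀ t ∈ Icc (0 : ℝ) parabolaEnd, 0 ≤ l (parabolaRay t)) → ∀ y ∈ F, 0 ≤ l y := by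
    intro l hl y hy
    rw [hF.eq_hull_inter] at hy
    refine PointedCone.nonneg_of_mem_hull ?_ hy
    rintro g ⟨hg, hgF⟩
    obtain ⟨t, ht, rfl⟩ := (planar_eq_zero_iff hg).1 ((hplanar g hg).2 hgF)
    exact hl t ht
  have hz : ∀ y ∈ F, y 2 = 0 := by
    intro y hy
    have h1 := hFpos (arcFunctional 0 0 0 1) (fun t _ => by simp [arcFunctional_parabolaRay]) y hy
    have h2 := hFpos (arcFunctional 0 0 0 (-1))
      (fun t _ => by simp [arcFunctional_parabolaRay]) y hy
    rw [arcFunctional_apply] at h1 h2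
    linarith
  have hwz : w 2 = 0 := by
    have : Submodule.span ℝ (F : Set (EuclideanSpace ℝ (Fin 4))) ≤
        LinearMap.ker (EuclideanSpace.proj 2 : EuclideanSpace ℝ (Fin 4) →L[ℝ] ℝ).toLinearMap :=
      Submodule.span_le.2 fun y hy => by simpa using hz y hy
    simpa using this hwF
  by_contra hnot
  obtain ⟨f, u, hfw, hfT⟩ := geometric_hahn_banach_point_closed
    (F.convex.convex_posTangentConeAt hx) (isClosed_posTangentConeAt _ _) hnot
  have hT : ∀ y, ∀ t : ℝ, 0 < t → x + t • y ∈ F → y ∈ posTangentConeAt (F : Set _) x :=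
    fun y t ht h => F.convex.mem_posTangentConeAt hx ht h
  have hu : u < 0 := by simpa using hfT 0 (hT 0 1 one_pos (by simpa using hx))
  have hfnn : ∀ y ∈ posTangentConeAt (F : Set (EuclideanSpace ℝ (Fin 4))) x, 0 ≤ f y := by
    intro y hy
    by_contra! hlt
    have h1 := hfT _ (F.convex.smul_mem_posTangentConeAt hx (div_pos_of_neg_of_neg hu hlt) hy)
    rw [map_smul, smul_eq_mul, div_mul_cancel₀ _ hlt.ne] at h1
    exact lt_irrefl _ h1
  have hfF : ∀ y ∈ F, 0 ≤ f y := fun y hy =>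
    hfnn y (hT y 1 one_pos (by simpa using F.add_mem hx hy))
  have hfx : f x = 0 := by
    have h1 := hfnn (-x) (hT (-x) 1 one_pos (by simp))
    rw [map_neg] at h1
    linarith [hfF x hx]
  have hfw0 : f w < 0 := hfw.trans hu
  obtain ⟨m, a, b, c, rfl⟩ := exists_eq_arcFunctional f
  have hh : ∀ t ∈ Icc (0 : ℝ) parabolaEnd, 0 ≤ m + a * t - b * t ^ 2 := by
    intro t ht
    rw [← arcFunctional_parabolaRay (c := c)]
    exact hfF _ ((hplanar _ (parabolaRay_mem ht)).1 (by simp [arcFunctional_parabolaRay]))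
  have hxz := hz x hx
  by_cases hma : 0 < m ∨ m = 0 ∧ 0 < a
  · obtain ⟨c', hc'⟩ := exists_nonneg_extension hma hh
    have h1 := hpos _ hc' (by
      rw [arcFunctional_apply, hxz] at hfx ⊢
      linarith)
    rw [arcFunctional_apply, hwz] at h1 hfw0
    linarith
  · push Not at hma
    have hm0 : 0 ≤ m := by simpa using hh 0 zero_mem_parabola
    obtain rfl : m = 0 := le_antisymm hma.1 hm0
    have ha : 0 ≤ a := by
      have := nonneg_at_zero_of_nonneg_Ioc (u := fun t => a - b * t) (by fun_prop) fun t ht => by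
        refine nonneg_of_mul_nonneg_right (a := t) ?_ ht.1
        linarith [hh t ⟨ht.1.le, by linarith [ht.2, four_thirds_lt_parabolaEnd]⟩]
      simpa using this
    obtain rfl : a = 0 := le_antisymm (hma.2 rfl) ha
    have hb : b ≤ 0 := by
      by_contra! hb
      have := hh 1 ⟨zero_le_one, by linarith [four_thirds_lt_parabolaEnd]⟩
      linarith
    rw [arcFunctional_apply] at hfx hfw0
    have hb0 : b ≠ 0 := by
      rintro rfl
      rw [hwz] at hfw0
      linarith
    have hx1 : x 1 = 0 := by
      rw [hxz] at hfx
      refine (mul_eq_zero.1 (?_ : b * x 1 = 0)).resolve_left hb0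
      linarith
    -- Since `x` lies on the cone over the parabola, `x 1 = 0` forces `x 0 = 0`.
    have hx0 : x 0 = 0 := by
      apply le_antisymm
      · have := hFpos (arcFunctional 0 1 0 0)
          (fun t ht => by simpa [arcFunctional_parabolaRay] using ht.1) x hx
        rw [arcFunctional_apply] at this
        linarith
      · have := nonneg_at_zero_of_nonneg_Ioc (u := fun δ => δ * x 3 + 2 * x 0) (by fun_prop)
          fun δ hδ => by
            have h1 := hFpos (arcFunctional (δ ^ 2) (-2 * δ) (-1) 0) (fun t _ => by
              rw [arcFunctional_parabolaRay]
              linarith [sq_nonneg (t - δ)]) x hx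
            rw [arcFunctional_apply, hx1] at h1
            refine nonneg_of_mul_nonneg_right (a := δ) ?_ hδ.1
            linarith
        have h2 : 0 ≤ 2 * x 0 := by simpa using this
        linarith
    have hw1 : 0 ≤ w 1 := by
      have := nonneg_at_zero_of_nonneg_Ioc (u := fun ε => w 1 - ε * w 0) (by fun_prop)
        fun ε hε => by
          obtain ⟨c', hc'⟩ := exists_nonneg_perturbation hε.1
          have h1 := hpos _ hc' (by rw [arcFunctional_apply, hxz, hx1, hx0]; ring)
          rw [arcFunctional_apply, hwz] at h1
          linarith
      simpa using this
    have := mul_nonneg (neg_nonneg.2 hb) hw1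
    rw [hwz] at hfw0
    linarith

theorem isTangentiallyExposed_cubicCone : IsTangentiallyExposed cubicCone := by
  rintro F ⟨hF, hne⟩ x hx
  rw [cubicCone_eq_hull] at hF hne ⊢
  obtain ⟨F, rfl, hF'⟩ := hF.exists_isFaceOf
  rcases hF'.exists_simplex_or_planar (fun h => hne (h ▸ rfl)) with ⟨V, hV, hFV⟩ | h
  · exact hV.posTangentConeAt_inter_span hF' hFV hx
  · exact hF'.posTangentConeAt_inter_span_planar h hx

/-! ### Regularity of the cone -/

/-- A cone over a compact set in an affine hyperplane that avoids the origin is closed. -/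
theorem IsCompact.isClosed_hull {E : Type*} [NormedAddCommGroup E] [NormedSpace ℝ E]
    [FiniteDimensional ℝ E] {G : Set E} (hG : IsCompact G) (hne : G.Nonempty) (φ : E →L[ℝ] ℝ)
    (hφ : ∀ g ∈ G, φ g = 1) : IsClosed (PointedCone.hull ℝ G : Set E) := by
  have hφ' : ∀ y ∈ convexHull ℝ G, φ y = 1 := fun y hy =>
    convexHull_min (t := {y | φ y = 1}) hφ
      (convex_hyperplane φ.toLinearMap.isLinear 1) hy
  have heq : (PointedCone.hull ℝ G : Set E) =
      {x | 0 ≤ φ x ∧ ∃ y ∈ convexHull ℝ G, x = φ x • y} := by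
    apply Subset.antisymm
    · intro x hx
      induction hx using Submodule.span_induction with
      | mem g hg => exact ⟨by simp [hφ g hg], g, subset_convexHull ℝ G hg, by simp [hφ g hg]⟩
      | zero =>
        obtain ⟨g, hg⟩ := hne
        exact ⟨by simp, g, subset_convexHull ℝ G hg, by simp⟩
      | add u v _ _ hu hv =>
        obtain ⟨hu0, y, hy, huy⟩ := hu
        obtain ⟨hv0, z, hz, hvz⟩ := hv
        refine ⟨by rw [map_add]; positivity, ?_⟩
        rcases (add_nonneg hu0 hv0).eq_or_lt with h | h
        · have h1 : φ u = 0 := by linarith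
          have h2 : φ v = 0 := by linarith
          rw [h1, zero_smul] at huy
          rw [h2, zero_smul] at hvz
          exact ⟨y, hy, by simp [huy, hvz]⟩
        · refine ⟨_, convex_convexHull ℝ G hy hz (div_nonneg hu0 h.le) (div_nonneg hv0 h.le)
            (by field_simp), ?_⟩
          rw [map_add, smul_add, smul_smul, smul_smul, mul_div_cancel₀ _ h.ne',
            mul_div_cancel₀ _ h.ne', ← huy, ← hvz]
      | smul c u _ hu =>
        obtain ⟨hu0, y, hy, huy⟩ := hu
        rw [Nonneg.mk_smul c.1 c.2 u]
        refine ⟨by rw [map_smul]; exact smul_nonneg c.2 hu0, y, hy, ?_⟩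
        rw [map_smul, smul_eq_mul, mul_smul, ← huy]
    · rintro x ⟨hx0, y, hy, hxy⟩
      rw [hxy]
      exact PointedCone.smul_mem _ hx0
        (convexHull_min PointedCone.subset_hull (PointedCone.convex _) hy)
  have hcomp := hG.isCompact_convexHull
  have := isCompact_iff_compactSpace.1 hcomp
  have hcl : IsClosed ({p : E × convexHull ℝ G | 0 ≤ φ p.1} ∩ {p | p.1 = φ p.1 • (p.2 : E)}) :=
    (isClosed_le (by fun_prop) (by fun_prop)).inter (isClosed_eq (by fun_prop) (by fun_prop))
  rw [heq]
  convert isClosedMap_fst_of_compactSpace _ hcl using 1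
  ext x
  simp

theorem isCompact_arcRays : IsCompact arcRays := by
  refine (isCompact_Icc.image ?_).union (isCompact_Icc.image ?_)
  · unfold cubicRay
    fun_prop
  · unfold parabolaRay
    fun_prop

theorem isClosed_cubicCone : IsClosed cubicCone := by
  rw [cubicCone_eq_hull]
  refine isCompact_arcRays.isClosed_hull ⟨_, parabolaRay_mem zero_mem_parabola⟩
    (EuclideanSpace.proj 3) ?_
  rintro g (⟨s, -, rfl⟩ | ⟨t, -, rfl⟩)
  · simp [cubicRay]
  · simp [parabolaRay]

theorem nonneg_of_mem_cubicCone {m a b c : ℝ} (h : ∀ g ∈ arcRays, 0 ≤ arcFunctional m a b c g)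
    {x : EuclideanSpace ℝ (Fin 4)} (hx : x ∈ cubicCone) : 0 ≤ arcFunctional m a b c x := by
  rw [cubicCone_eq_hull] at hx
  exact PointedCone.nonneg_of_mem_hull h hx

theorem cubicCone_salient : ∀ x ∈ cubicCone, -x ∈ cubicCone → x = 0 := by
  intro x hx hx'
  -- The coordinates of the generators are bounded, so functionals with a dominating constant
  -- term vanish at `x`.
  have key : ∀ a b c : ℝ, |a| ≤ 1 → |b| ≤ 1 → |c| ≤ 1 →
      9 * x 3 - a * x 0 - b * x 1 - c * x 2 = 0 := by
    intro a b c ha hb hc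
    obtain ⟨ha1, ha2⟩ := abs_le.1 ha
    obtain ⟨hb1, hb2⟩ := abs_le.1 hb
    obtain ⟨hc1, hc2⟩ := abs_le.1 hc
    have hl : ∀ g ∈ arcRays, 0 ≤ arcFunctional 9 a b c g := by
      refine arcFunctional_nonneg (fun s hs => ?_) fun t ht => ?_
      · have h2 := pow_le_one₀ hs.1 hs.2 (n := 2)
        have h3 := pow_le_one₀ hs.1 hs.2 (n := 3)
        have e1 := mul_nonneg (by linarith : 0 ≤ a + 1) hs.1
        have e2 := mul_nonneg (by linarith : 0 ≤ b + 1) (pow_nonneg hs.1 2)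
        have e3 := mul_nonneg (by linarith : 0 ≤ c + 1) (pow_nonneg hs.1 3)
        linarith [hs.2]
      · have ht2 : t ≤ 2 := ht.2.trans parabolaEnd_lt_two.le
        have h2 : t ^ 2 ≤ 4 := by nlinarith [ht.1]
        have e1 := mul_nonneg (by linarith : 0 ≤ a + 1) ht.1
        have e2 := mul_nonneg (by linarith : 0 ≤ 1 - b) (sq_nonneg t)
        linarith
    have h1 := nonneg_of_mem_cubicCone hl hx
    have h2 := nonneg_of_mem_cubicCone hl hx'
    rw [map_neg] at h2
    rw [arcFunctional_apply] at h1 h2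
    linarith
  have h0 := key 0 0 0 (by simp) (by simp) (by simp)
  have h1 := key 1 0 0 (by simp) (by simp) (by simp)
  have h2 := key 0 1 0 (by simp) (by simp) (by simp)
  have h3 := key 0 0 1 (by simp) (by simp) (by simp)
  ext i
  fin_cases i <;> simp <;> linarith

/-! ### Failure of facial dual completeness -/

/-- The zeros in a convex set of a nonnegative linear functional form a face. -/
theorem Convex.isConvexFace_zero {E : Type*} [NormedAddCommGroup E] [NormedSpace ℝ E] {S : Set E}
    (hS : Convex ℝ S) (l : E →L[ℝ] ℝ) (hl : ∀ x ∈ S, 0 ≤ l x) {x₀ : E} (hx₀ : x₀ ∈ S)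
    (h0 : l x₀ = 0) : IsConvexFace S {x ∈ S | l x = 0} where
  nonempty := ⟨x₀, hx₀, h0⟩
  convex := hS.inter (convex_hyperplane l.toLinearMap.isLinear 0)
  isExtreme := by
    refine ⟨fun x hx => hx.1, ?_⟩
    rintro x hx y hy _ ⟨-, hz⟩ ⟨a, b, ha, hb, -, rfl⟩
    refine ⟨hx, ?_⟩
    rw [map_add, map_smul, map_smul, smul_eq_mul, smul_eq_mul] at hz
    have h1 := mul_nonneg ha.le (hl x hx)
    have h2 := mul_nonneg hb.le (hl y hy)
    exact (mul_eq_zero.1 (by linarith : a * l x = 0)).resolve_left ha.ne'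

theorem parabolaRay_mem_cubicCone {t : ℝ} (ht : t ∈ Icc (0 : ℝ) parabolaEnd) :
    parabolaRay t ∈ cubicCone := by
  rw [cubicCone_eq_hull]
  exact parabolaRay_mem_hull ht

theorem cubicRay_mem_cubicCone {s : ℝ} (hs : s ∈ Icc (0 : ℝ) 1) : cubicRay s ∈ cubicCone := by
  rw [cubicCone_eq_hull]
  exact Submodule.subset_span (cubicRay_mem hs)

theorem not_isFaciallyDualComplete_cubicCone : ¬ IsFaciallyDualComplete cubicCone := by
  intro hfdc
  have hT := four_thirds_lt_parabolaEnd
  set F : Set (EuclideanSpace ℝ (Fin 4)) := {x ∈ cubicCone | arcFunctional 0 0 0 1 x = 0} with hF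
  have hface : IsProperFace cubicCone F := by
    refine ⟨(homogenization cubicBody).convex.isConvexFace_zero _
      (fun x hx => nonneg_of_mem_cubicCone planar_nonneg hx)
      (parabolaRay_mem_cubicCone zero_mem_parabola) (by simp [arcFunctional_parabolaRay]), ?_⟩
    intro h
    have h1 : cubicRay 1 ∈ F := h ▸ cubicRay_mem_cubicCone (by norm_num)
    have h2 := h1.2
    rw [arcFunctional_cubicRay] at h2
    norm_num at h2
  have hcl := hfdc F hface
  -- The functional `y` is the limit of `y - ε x`, which differ from elements of the dual cone
  -- by multiples of `z`.
  have hlim : (!₂[-0, 1, 0, 0] : EuclideanSpace ℝ (Fin 4)) ∈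
      (ProperCone.innerDual cubicCone : Set (EuclideanSpace ℝ (Fin 4))) +
        {s | ∀ x ∈ F, inner ℝ s x = 0} := by
    have hcont : Continuous fun ε : ℝ => (!₂[-ε, 1, 0, 0] : EuclideanSpace ℝ (Fin 4)) := by
      fun_prop
    refine hcl.mem_of_tendsto ((hcont.tendsto 0).mono_left (nhdsWithin_le_nhds (s := Ioi 0))) ?_
    filter_upwards [self_mem_nhdsWithin] with ε hε
    obtain ⟨c, hc⟩ := exists_nonneg_perturbation hε
    refine ⟨!₂[-ε, 1, -c, 0], ?_, !₂[0, 0, c, 0], ?_, ?_⟩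
    · rw [SetLike.mem_coe, ProperCone.mem_innerDual]
      intro x hx
      have := nonneg_of_mem_cubicCone hc hx
      rw [arcFunctional_apply] at this
      simp only [PiLp.inner_apply, Fin.sum_univ_four]
      simp
      linarith
    · rintro x ⟨-, hx⟩
      rw [arcFunctional_apply] at hx
      have hx2 : x 2 = 0 := by linarith
      simp [PiLp.inner_apply, Fin.sum_univ_four, hx2]
    · ext i
      fin_cases i <;> simp
  obtain ⟨k, hk, p, hp, hkp⟩ := hlim
  have hpar : ∀ t ∈ Icc (0 : ℝ) parabolaEnd, -(p 0 * t) + p 1 * t ^ 2 + p 3 = 0 := by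
    intro t ht
    have := hp (parabolaRay t)
      ⟨parabolaRay_mem_cubicCone ht, by simp [arcFunctional_parabolaRay]⟩
    simp only [PiLp.inner_apply, Fin.sum_univ_four, parabolaRay] at this
    simp at this
    linarith
  have h0 := hpar 0 zero_mem_parabola
  have h1 := hpar 1 ⟨by norm_num, by linarith⟩
  have h2 := hpar (1 / 2) ⟨by norm_num, by linarith⟩
  have hcoord : ∀ i, k i + p i = (!₂[-0, 1, 0, 0] : EuclideanSpace ℝ (Fin 4)) i := fun i => by
    rw [← hkp]; rfl
  have hk0 := hcoord 0
  have hk1 := hcoord 1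
  have hk3 := hcoord 3
  simp at hk0 hk1 hk3
  have hlow := nonneg_at_zero_of_nonneg_Ioc (u := fun s => -1 - k 2 * s) (by fun_prop)
    fun s hs => by
      rw [SetLike.mem_coe, ProperCone.mem_innerDual] at hk
      have := hk (cubicRay_mem_cubicCone ⟨hs.1.le, hs.2⟩)
      simp only [PiLp.inner_apply, Fin.sum_univ_four, cubicRay] at this
      simp at this
      rw [show k 0 = 0 by linarith, show k 1 = 1 by linarith, show k 3 = 0 by linarith] at this
      refine nonneg_of_mul_nonneg_right (a := s ^ 2) ?_ (pow_pos hs.1 2)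
      linarith
  norm_num at hlow

/-! ### The tangent cones at the origin of the slice -/

/-- Let a convex set contain, near its point `o`, the arc `o - s e₀ - s² e₁ - s³ e₂` of a twisted
cubic and the arc `o - t e₀ + t² e₁` of a parabola. Let `Z ≤ 0` on the set, and let every
`Y - ε X` with `ε > 0` become nonnegative on it after adding a multiple of `Z`. Then, in the tangent
cone at `o`, the ray through `-e₀` is a face that is not exposed, and tangential exposedness fails
at `-e₀` for the face in the hyperplane `Z = 0`. -/
theorem Convex.not_exposed_posTangentConeAt {E : Type*} [NormedAddCommGroup E] [NormedSpace ℝ E]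
    {S : Set E} (hS : Convex ℝ S) {o e₀ e₁ e₂ : E} (ho : o ∈ S)
    (hpar : ∀ t ∈ Ioc (0 : ℝ) 1, o + t • (-e₀ + t • e₁) ∈ S)
    (hcub : ∀ s ∈ Ioc (0 : ℝ) 1, o + s • (-e₀ - s • e₁ - s ^ 2 • e₂) ∈ S)
    (X Y Z : E →L[ℝ] ℝ) (hX : X o = 0) (hY : Y o = 0) (hZ : Z o = 0) (hYe₀ : Y e₀ = 0)
    (hYe₁ : Y e₁ = 1) (hZe₀ : Z e₀ = 0) (hZe₁ : Z e₁ = 0) (hZS : ∀ x ∈ S, Z x ≤ 0)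
    (hYS : ∀ ε : ℝ, 0 < ε → ∃ c : ℝ, ∀ x ∈ S, 0 ≤ Y x - ε * X x - c * Z x) :
    ¬ IsFaciallyExposed (posTangentConeAt S o) ∧ ¬ IsTangentiallyExposed (posTangentConeAt S o) := by
  set T := posTangentConeAt S o with hTdef
  have hT : Convex ℝ T := hS.convex_posTangentConeAt ho
  have hparT : ∀ t ∈ Ioc (0 : ℝ) 1, -e₀ + t • e₁ ∈ T := fun t ht =>
    hS.mem_posTangentConeAt ho ht.1 (hpar t ht)
  have hcubT : ∀ s ∈ Ioc (0 : ℝ) 1, -e₀ - s • e₁ - s ^ 2 • e₂ ∈ T := fun s hs =>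
    hS.mem_posTangentConeAt ho hs.1 (hcub s hs)
  have hray : -e₀ ∈ T := by
    have hc : Continuous fun t : ℝ => -e₀ + t • e₁ := by fun_prop
    have h := (hc.tendsto 0).mono_left (nhdsWithin_le_nhds (s := Ioi 0))
    simp only [zero_smul, add_zero] at h
    refine (isClosed_posTangentConeAt S o).mem_of_tendsto h ?_
    filter_upwards [Ioc_mem_nhdsGT one_pos] with t ht using hparT t ht
  have h0T : (0 : E) ∈ T := hS.mem_posTangentConeAt ho one_pos (by simpa using ho)
  have hv : -e₀ + e₁ ∈ T := by simpa using hparT 1 (by norm_num)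
  have hZT : ∀ v ∈ T, 0 ≤ (-Z) v := fun v hv =>
    hS.nonneg_of_mem_posTangentConeAt ho (-Z) (fun x hx => by simpa using hZS x hx)
      (by simpa using hZ) hv
  have hYT : ∀ v ∈ T, (-Z) v = 0 → 0 ≤ Y v := by
    intro v hv hv0
    have hv0 : Z v = 0 := by simpa using hv0
    have := nonneg_at_zero_of_nonneg_Ioc (u := fun ε => Y v - ε * X v) (by fun_prop)
      fun ε hε => by
        obtain ⟨c, hc⟩ := hYS ε hε.1
        have := hS.nonneg_of_mem_posTangentConeAt ho (Y - ε • X - c • Z)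
          (fun x hx => by simpa using hc x hx) (by simp [hX, hY, hZ]) hv
        simpa [hv0] using this
    simpa using this
  have hP := hT.isConvexFace_zero (-Z) hZT hray (by simp [hZe₀])
  set P := {v ∈ T | (-Z) v = 0} with hPdef
  have hrayP : -e₀ ∈ P := ⟨hray, by simp [hZe₀]⟩
  have hvP : -e₀ + e₁ ∈ P := ⟨hv, by simp [hZe₀, hZe₁]⟩
  have hR := hP.convex.isConvexFace_zero Y (fun v hv => hYT v hv.1 hv.2) hrayP (by simp [hYe₀])
  constructor
  · intro hexp
    obtain ⟨l, hl⟩ := hexp {v ∈ P | Y v = 0}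
      ⟨⟨hR.nonempty, hR.convex, hP.isExtreme.trans hR.isExtreme⟩, fun h => by
        have h1 : -e₀ + e₁ ∈ {v ∈ P | Y v = 0} := h ▸ hv
        have h2 := h1.2
        simp [hYe₀, hYe₁] at h2⟩ hR.nonempty
    have hmem0 : (0 : E) ∈ {v ∈ P | Y v = 0} := ⟨⟨h0T, by simp⟩, by simp⟩
    have hle : ∀ y ∈ T, l y ≤ 0 := fun y hy => by
      rw [hl] at hmem0
      simpa using hmem0.2 y hy
    have hle₀ : l e₀ = 0 := by
      have h1 : -e₀ ∈ {v ∈ P | Y v = 0} := ⟨hrayP, by simp [hYe₀]⟩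
      rw [hl] at h1
      have h2 := h1.2 0 h0T
      have h3 := hle _ hray
      simp only [map_neg, map_zero] at h2 h3
      linarith
    -- The two arcs bend away from the ray on opposite sides.
    have hle₁ : 0 ≤ l e₁ := by
      have := nonneg_at_zero_of_nonneg_Ioc (u := fun s => l e₁ + s * l e₂) (by fun_prop)
        fun s hs => by
          have h1 := hle _ (hcubT s hs)
          simp only [map_sub, map_neg, map_smul, smul_eq_mul, hle₀] at h1
          refine nonneg_of_mul_nonneg_right (a := s) ?_ hs.1
          linarith
      simpa using this
    have hbad : -e₀ + e₁ ∈ {v ∈ P | Y v = 0} := by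
      rw [hl]
      refine ⟨hv, fun y hy => (hle y hy).trans ?_⟩
      simpa [hle₀] using hle₁
    have h2 := hbad.2
    simp [hYe₀, hYe₁] at h2
  · intro htan
    have hPT : IsProperFace T P := by
      refine ⟨hP, fun h => ?_⟩
      -- Otherwise `Y` is nonnegative on `T`, although the cubic arc has directions with `Y < 0`.
      have h1 := nonneg_at_zero_of_nonneg_Ioc (u := fun s => -1 - s * Y e₂) (by fun_prop)
        fun s hs => by
          have h2 : -e₀ - s • e₁ - s ^ 2 • e₂ ∈ P := h ▸ hcubT s hs
          have h3 := hYT _ h2.1 h2.2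
          simp only [map_sub, map_neg, map_smul, smul_eq_mul, hYe₀, hYe₁] at h3
          refine nonneg_of_mul_nonneg_right (a := s) ?_ hs.1
          linarith
      norm_num at h1
    have hdir : -e₁ ∈ posTangentConeAt T (-e₀) := by
      have hc : Continuous fun s : ℝ => -e₁ - s • e₂ := by fun_prop
      have h := (hc.tendsto 0).mono_left (nhdsWithin_le_nhds (s := Ioi 0))
      simp only [zero_smul, sub_zero] at h
      refine (isClosed_posTangentConeAt T (-e₀)).mem_of_tendsto h ?_
      filter_upwards [Ioc_mem_nhdsGT one_pos] with s hs
      refine hT.mem_posTangentConeAt hray hs.1 ?_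
      convert hcubT s hs using 1
      module
    have hspan : -e₁ ∈ (Submodule.span ℝ P : Set E) := by
      have := sub_mem (Submodule.subset_span (R := ℝ) hrayP) (Submodule.subset_span hvP)
      simpa using this
    have hbad : -e₁ ∈ posTangentConeAt P (-e₀) := by
      rw [← htan P hPT (-e₀) hrayP]
      exact ⟨hdir, hspan⟩
    have := hP.convex.nonneg_of_mem_posTangentConeAt hrayP Y (fun v hv => hYT v hv.1 hv.2)
      (by simp [hYe₀]) hbad
    rw [map_neg, hYe₁] at this
    norm_num at this

theorem lift_mem_cubicCone {x : EuclideanSpace ℝ (Fin 3)} (hx : x ∈ cubicBody) :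
    (!₂[x 0, x 1, x 2, 1] : EuclideanSpace ℝ (Fin 4)) ∈ cubicCone :=
  Submodule.subset_span (mem_image_of_mem _ hx)

theorem not_exposed_posTangentConeAt_cubicBody :
    ¬ IsFaciallyExposed (posTangentConeAt cubicBody 0) ∧
      ¬ IsTangentiallyExposed (posTangentConeAt cubicBody 0) := by
  have hT := four_thirds_lt_parabolaEnd
  refine (convex_convexHull ℝ _).not_exposed_posTangentConeAt
    (e₀ := EuclideanSpace.single 0 1) (e₁ := EuclideanSpace.single 1 1)
    (e₂ := EuclideanSpace.single 2 1) ?_ ?_ ?_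
    (EuclideanSpace.proj 0) (EuclideanSpace.proj 1) (EuclideanSpace.proj 2)
    (by simp) (by simp) (by simp) (by simp) (by simp) (by simp) (by simp) ?_ ?_
  · refine subset_convexHull ℝ _ (Or.inl ⟨0, by norm_num, ?_⟩)
    ext i
    fin_cases i <;> simp
  · intro t ht
    refine subset_convexHull ℝ _ (Or.inr ⟨t, ⟨ht.1.le, ?_⟩, ?_⟩)
    · exact (by linarith [ht.2] : t ≤ parabolaEnd)
    · ext i
      fin_cases i <;> simp
      ring
  · intro s hs
    refine subset_convexHull ℝ _ (Or.inl ⟨s, ⟨hs.1.le, hs.2⟩, ?_⟩)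
    ext i
    fin_cases i <;> simp <;> ring
  · intro x hx
    have := nonneg_of_mem_cubicCone planar_nonneg (lift_mem_cubicCone hx)
    simpa [arcFunctional_apply] using this
  · intro ε hε
    obtain ⟨c, hc⟩ := exists_nonneg_perturbation hε
    refine ⟨c, fun x hx => ?_⟩
    have := nonneg_of_mem_cubicCone hc (lift_mem_cubicCone hx)
    simp [arcFunctional_apply] at this
    simp
    linarith

theorem not_exposed_posTangentConeAt_cubicCone :
    ¬ IsFaciallyExposed (posTangentConeAt cubicCone !₂[0, 0, 0, 1]) ∧
      ¬ IsTangentiallyExposed (posTangentConeAt cubicCone !₂[0, 0, 0, 1]) := by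
  have hT := four_thirds_lt_parabolaEnd
  refine (homogenization cubicBody).convex.not_exposed_posTangentConeAt
    (e₀ := EuclideanSpace.single 0 1) (e₁ := EuclideanSpace.single 1 1)
    (e₂ := EuclideanSpace.single 2 1) ?_ ?_ ?_
    (EuclideanSpace.proj 0) (EuclideanSpace.proj 1) (EuclideanSpace.proj 2)
    (by simp) (by simp) (by simp) (by simp) (by simp) (by simp) (by simp) ?_ ?_
  · change _ ∈ cubicCone
    convert parabolaRay_mem_cubicCone zero_mem_parabola using 1
    simp [parabolaRay]
  · intro t ht
    change _ ∈ cubicCone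
    convert parabolaRay_mem_cubicCone (t := t) ⟨ht.1.le, by linarith [ht.2]⟩ using 1
    ext i
    fin_cases i <;> simp [parabolaRay]
    ring
  · intro s hs
    change _ ∈ cubicCone
    convert cubicRay_mem_cubicCone (s := s) ⟨hs.1.le, hs.2⟩ using 1
    ext i
    fin_cases i <;> simp [cubicRay] <;> ring
  · intro x hx
    have := nonneg_of_mem_cubicCone planar_nonneg hx
    simpa [arcFunctional_apply] using this
  · intro ε hε
    obtain ⟨c, hc⟩ := exists_nonneg_perturbation hε
    refine ⟨c, fun x hx => ?_⟩
    have := nonneg_of_mem_cubicCone hc hx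
    rw [arcFunctional_apply] at this
    simp
    linarith

theorem mainTheorem4 :
    -- `K` is a regular cone (it is a convex cone by construction)
    (IsClosed cubicCone ∧ (∀ x ∈ cubicCone, -x ∈ cubicCone → x = 0) ∧
      (interior cubicCone).Nonempty) ∧
    IsFaciallyExposed cubicCone ∧
    IsTangentiallyExposed cubicCone ∧
    ¬ IsFaciallyDualComplete cubicCone ∧
    -- the tangent cone of the slice `C` at the origin of `ℝ³`
    (¬ IsFaciallyExposed (posTangentConeAt cubicBody 0) ∧
      ¬ IsTangentiallyExposed (posTangentConeAt cubicBody 0)) ∧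
    -- the tangent cone of `K` at the corresponding point
    (¬ IsFaciallyExposed (posTangentConeAt cubicCone !₂[0, 0, 0, 1]) ∧
      ¬ IsTangentiallyExposed (posTangentConeAt cubicCone !₂[0, 0, 0, 1])) := by
  refine ⟨⟨isClosed_cubicCone, cubicCone_salient, ?_⟩, isFaciallyExposed_cubicCone,
    isTangentiallyExposed_cubicCone, not_isFaciallyDualComplete_cubicCone,
    not_exposed_posTangentConeAt_cubicBody, not_exposed_posTangentConeAt_cubicCone⟩
  rw [cubicCone_eq_hull]
  exact interior_hull_arcRays_nonempty
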